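/- All objects are $C^\infty$. Let $N$ be a finite-dimensional manifold without boundary. An almost symplectic form on a manifold $M$ is a smooth non-degenerate $2$-form $\omega$ (not necessarily closed). For a function $f\in C^\infty(M)$, a smooth vector field $X$ on $M$ is called $\omega$-Hamiltonian with Hamiltonian function $f$ (written $X=X_f$) if $$L_X\omega=0,\qquad i(X)\omega=-df .$$ A smooth left action of a Lie group $G$ (with Lie algebra $\mathfrak g$) on $M$ is $\omega$-Hamiltonian if $G$ acts by transformations preserving $\omega$ and, for each $\xi\in\mathfrak g$, the infinitesimal transformation $\xi_M(x)=\frac{d}{dt}\big|_{t=0}\exp(t\xi)\cdot x$ is an $\omega$-Hamiltonian vector field of some function. An equivariant momentum map of a smooth action is a smooth map $\Phi:M\to\mathfrak g^*$ such that, for each $\xi\in\mathfrak g$, $\xi_M$ is $\omega$-Hamiltonian with Hamiltonian function $\langle\Phi,\xi\rangle$, and $\Phi(g\cdot x)=\mathrm{Ad}^*_g\,\Phi(x)$ for all $g\in G$, $x\in M$, where $\langle \mathrm{Ad}^*_g\theta,\xi\rangle=\langle\theta,\mathrm{Ad}_{g^{-1}}\xi\rangle$. Let $(x^i)$ be local coordinates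 on $N$ and $(x^i,y^i)$ the corresponding natural coordinates on $TN$. The complete lifts to $TN$ of a function $f$ (possibly with values in a finite-dimensional vector space), of a vector field $X=\xi^i\,\partial/\partial x^i$ and of a tensor field $\sigma=\sigma_{ij}\,dx^i\otimes dx^j$ of type $(0,2)$ are $$f^c(y)=y(f)=y^i\frac{\partial f}{\partial x^i},\qquad X^c=\xi^i\frac{\partial}{\partial x^i}+y^j\frac{\partial\xi^i}{\partial x^j}\frac{\partial}{\partial y^i},$$ $$\sigma^c=y^k\frac{\partial\sigma_{ij}}{\partial x^k}\,dx^i\otimes dx^j+\sigma_{ij}\,dx^i\otimes dy^j+\sigma_{ij}\,dy^i\otimes dx^j .$$ Let $\sigma$ be an almost symplectic form on $N$. Then: 1. $\sigma^c$ is an almost symplectic form on $TN$. 2. If $X_f$ is a $\sigma$-Hamiltonian vector field on $N$ with Hamiltonian function $f$, then $(X_f)^c$ is a $\sigma^c$-Hamiltonian vector field on $TN$ with Hamiltonian function $f^c$. 3. If a Lie group $G$ has a $\sigma$-Hamiltonian action on $N$, then the differential of the action, in which $g\in G$ acts on $TN$ by the differential of $x\mapsto g\cdot x$, is a $\sigma^c$-Hamiltonian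 action of $G$ on $TN$. 4. If $\Phi:N\to\mathfrak g^*$ is an equivariant momentum map, with respect to $\sigma$, of a smooth action of $G$ on $N$, then the differential of the action is a smooth action of $G$ on $TN$ and $\Phi^c:TN\to\mathfrak g^*$ is an equivariant momentum map of it with respect to $\sigma^c$. In particular, if $G$ has a $\sigma$-Hamiltonian action on $N$ with an equivariant momentum map $\Phi$, then the differential of this action is a $\sigma^c$-Hamiltonian action on $TN$ with the equivariant momentum map $\Phi^c$. -/

import Mathlib

open Bundle VectorField
open scoped Manifold ContDiff Topology

noncomputable section

namespace AlmostSymplectic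

/-! ### Tensor fields, almost symplectic forms and Hamiltonian vector fields -/

section Basic

variable {E : Type*} [NormedAddCommGroup E] [NormedSpace ℝ E]
  {H : Type*} [TopologicalSpace H] (I : ModelWithCorners ℝ E H)
  {M : Type*} [TopologicalSpace M] [ChartedSpace H M]

/-- Fields of covectors on `M` (no smoothness required). -/
abbrev CovectorField (M : Type*) [TopologicalSpace M] [ChartedSpace H M] : Type _ :=
  (x : M) → (TangentSpace I x →L[ℝ] ℝ)

/-- Fields of bilinear forms on the tangent spaces of `M`, that is, tensor fields of type `(0,2)`
(no smoothness required). -/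
abbrev BilinField (M : Type*) [TopologicalSpace M] [ChartedSpace H M] : Type _ :=
  (x : M) → (TangentSpace I x →L[ℝ] TangentSpace I x →L[ℝ] ℝ)

/-- The vector field `X` is smooth on the set `U`. -/
def SmoothVectorFieldOn [IsManifold I ∞ M] (X : (x : M) → TangentSpace I x) (U : Set M) : Prop :=
  ContMDiffOn I I.tangent ∞ (fun x : M => (⟨x, X x⟩ : TangentBundle I M)) U

/-- An almost symplectic form on `M`: a smooth, skew-symmetric, non-degenerate field of bilinear
forms. It does not have to be closed. -/
structure IsAlmostSymplectic [IsManifold I ∞ M] (Ω : BilinField I M) : Prop where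
  smooth : ContMDiff I (I.prod 𝓘(ℝ, E →L[ℝ] E →L[ℝ] ℝ)) ∞
    (fun x : M => TotalSpace.mk' (E →L[ℝ] E →L[ℝ] ℝ)
      (E := fun x : M => (TangentSpace I x →L[ℝ] TangentSpace I x →L[ℝ] ℝ)) x (Ω x))
  skew : ∀ (x : M) (u v : TangentSpace I x), Ω x u v = - Ω x v u
  nondegenerate : ∀ (x : M) (u : TangentSpace I x), (∀ v : TangentSpace I x, Ω x u v = 0) → u = 0

/-- The value at `x` of `(L_X Ω)(Y, Z) = X(Ω(Y, Z)) - Ω([X, Y], Z) - Ω(Y, [X, Z])`. -/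
def lieDerivative (X : (x : M) → TangentSpace I x) (Ω : BilinField I M)
    (Y Z : (x : M) → TangentSpace I x) (x : M) : ℝ :=
  mvfderiv I (fun p : M => Ω p (Y p) (Z p)) x (X x)
    - Ω x (mlieBracket I X Y x) (Z x) - Ω x (Y x) (mlieBracket I X Z x)

/-- `L_X Ω = 0`: the Lie derivative vanishes on all pairs of smooth, locally defined vector
fields. -/
def LieDerivativeEqZero [IsManifold I ∞ M] (X : (x : M) → TangentSpace I x)
    (Ω : BilinField I M) : Prop :=
  ∀ (U : Set M), IsOpen U → ∀ Y Z : (x : M) → TangentSpace I x,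
    SmoothVectorFieldOn I Y U → SmoothVectorFieldOn I Z U →
      ∀ x ∈ U, lieDerivative I X Ω Y Z x = 0

/-- `X` is the `Ω`-Hamiltonian vector field of the function `f`: `X` and `f` are smooth,
`L_X Ω = 0` and `i(X) Ω = - df`. -/
structure IsHamiltonian [IsManifold I ∞ M] (Ω : BilinField I M)
    (X : (x : M) → TangentSpace I x) (f : M → ℝ) : Prop where
  smooth_field : SmoothVectorFieldOn I X Set.univ
  smooth_function : ContMDiff I 𝓘(ℝ, ℝ) ∞ f
  lie_eq_zero : LieDerivativeEqZero I X Ω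
  contraction : ∀ (x : M) (v : TangentSpace I x),
    Ω x (X x) v = - mvfderiv I f x v

end Basic

/-! ### Lie group actions and momentum maps -/

section Action

variable {EG : Type*} [NormedAddCommGroup EG] [NormedSpace ℝ EG]
  {HG : Type*} [TopologicalSpace HG] (IG : ModelWithCorners ℝ EG HG)
  {G : Type*} [TopologicalSpace G] [ChartedSpace HG G] [Group G]
  {E : Type*} [NormedAddCommGroup E] [NormedSpace ℝ E]
  {H : Type*} [TopologicalSpace H] (I : ModelWithCorners ℝ E H)
  {M : Type*} [TopologicalSpace M] [ChartedSpace H M]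

/-- `ρ` is a smooth left action of the group `G` on the manifold `M`. -/
structure IsSmoothAction (ρ : G → M → M) : Prop where
  one : ∀ x : M, ρ 1 x = x
  mul : ∀ (g h : G) (x : M), ρ (g * h) x = ρ g (ρ h x)
  smooth : ContMDiff (IG.prod I) I ∞ (fun p : G × M => ρ p.1 p.2)

/-- The infinitesimal transformation of `M` defined by an element `ξ` of the Lie algebra: its value
at `x` is the derivative at the unit, in the direction `ξ`, of the orbit map `g ↦ ρ g x`, i.e. the
velocity at `t = 0` of `t ↦ ρ (exp (t ξ)) x`. (One has `ρ 1 x = x` for an action.) -/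
def infinitesimal (ρ : G → M → M) (ξ : GroupLieAlgebra IG G) (x : M) : TangentSpace I x :=
  (mfderiv IG I (fun g : G => ρ g x) 1 : EG →L[ℝ] E) ξ

/-- The adjoint representation: `Ad_g` is the differential at the unit of `h ↦ g h g⁻¹`. -/
def adjointMap (g : G) : GroupLieAlgebra IG G →L[ℝ] GroupLieAlgebra IG G :=
  (mfderiv IG IG (fun h : G => g * h * g⁻¹) 1 : EG →L[ℝ] EG)

/-- The dual `𝔤*` of the Lie algebra: the Lie algebra `TangentSpace IG (1 : G)` is by definition the
model space `EG`, which also provides the (immaterial) norm of `𝔤*`. -/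
abbrev DualLieAlgebra (EG : Type*) [NormedAddCommGroup EG] [NormedSpace ℝ EG] : Type _ :=
  EG →L[ℝ] ℝ

/-- The coadjoint action of `G` on `𝔤*`: `(Ad*_g θ)(ξ) = θ(Ad_{g⁻¹} ξ)`. -/
def coadjoint (g : G) (θ : DualLieAlgebra EG) : DualLieAlgebra EG :=
  θ.comp (adjointMap IG g⁻¹ : EG →L[ℝ] EG)

/-- An `Ω`-Hamiltonian action: a smooth action by transformations that preserve `Ω`, such that all
the infinitesimal transformations are `Ω`-Hamiltonian vector fields. -/
structure IsHamiltonianAction [IsManifold I ∞ M] (Ω : BilinField I M) (ρ : G → M → M) : Prop where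
  action : IsSmoothAction IG I ρ
  preserves : ∀ (g : G) (x : M) (u v : TangentSpace I x),
    Ω (ρ g x) (mfderiv I I (ρ g) x u) (mfderiv I I (ρ g) x v) = Ω x u v
  hamiltonian : ∀ ξ : GroupLieAlgebra IG G, ∃ f : M → ℝ,
    IsHamiltonian I Ω (infinitesimal IG I ρ ξ) f

/-- An equivariant momentum map of the action `ρ`: a smooth map `Φ : M → 𝔤*` such that, for every
`ξ`, the function `⟨Φ, ξ⟩` is a Hamiltonian function of the infinitesimal transformation of `ξ`, and
which is equivariant with respect to `ρ` and to the coadjoint action. -/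
structure IsEquivariantMomentumMap [IsManifold I ∞ M] (Ω : BilinField I M) (ρ : G → M → M)
    (Φ : M → DualLieAlgebra EG) : Prop where
  smooth : ContMDiff I 𝓘(ℝ, DualLieAlgebra EG) ∞ Φ
  hamiltonian : ∀ ξ : GroupLieAlgebra IG G,
    IsHamiltonian I Ω (infinitesimal IG I ρ ξ) (fun x => Φ x ξ)
  equivariant : ∀ (g : G) (x : M), Φ (ρ g x) = coadjoint IG g (Φ x)

end Action

/-! ### Complete lifts to the tangent bundle

Let `y` be a tangent vector at `x = y.proj`. The tangent space `TangentSpace I.tangent y` of the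
tangent bundle is `E × E` by definition, and an element `U` of it is the pair of the components
`(dx^i(U), dy^i(U))` in the natural chart `(x^i, y^i)` of the tangent bundle which comes from the
preferred chart of the base manifold at `x`; in the same way `TangentSpace I x` is `E`
(Mathlib's `mfderiv_extChartAt_self`). The component `U.1` is the projection of `U`. -/

section CompleteLift

variable {E : Type*} [NormedAddCommGroup E] [NormedSpace ℝ E]
  {H : Type*} [TopologicalSpace H] (I : ModelWithCorners ℝ E H)
  {N : Type*} [TopologicalSpace N] [ChartedSpace H N]

/-- The basis vectors of the chart at `x`: the differential, at the point with coordinates `z`, of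
the inverse of the chart. -/
def frame (x : N) (z : E) : TangentSpace 𝓘(ℝ, E) z →L[ℝ] TangentSpace I ((extChartAt I x).symm z) :=
  mfderivWithin 𝓘(ℝ, E) I (extChartAt I x).symm (Set.range I) z

/-- The components `ξ^i` of a vector field in the chart at `x`, as functions of the coordinates. -/
def vectorComponents (X : (p : N) → TangentSpace I p) (x : N) (z : E) : E :=
  mvfderiv I (extChartAt I x) ((extChartAt I x).symm z) (X ((extChartAt I x).symm z))

/-- The components `α_i` of a covector field in the chart at `x`, as functions of the
coordinates. -/
def covectorComponents (α : CovectorField I N) (x : N) (z : E) : E →L[ℝ] ℝ :=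
  (α ((extChartAt I x).symm z)).comp (frame I x z)

/-- The components `σ_ij` of a field of bilinear forms in the chart at `x`, as functions of the
coordinates. -/
def bilinComponents (σ : BilinField I N) (x : N) (z : E) : E →L[ℝ] E →L[ℝ] ℝ :=
  ContinuousLinearMap.bilinearComp (E := E) (F := E) (E' := E) (F' := E)
    (σ ((extChartAt I x).symm z)) (frame I x z) (frame I x z)

/-- The complete lift `f^c(y) = y(f) = df(y)` of a function, possibly with vector values. -/
def functionLift {F : Type*} [NormedAddCommGroup F] [NormedSpace ℝ F] (f : N → F)
    (y : TangentBundle I N) : F :=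
  mvfderiv I f y.proj y.2

variable [IsManifold I ∞ N]

/-- The complete lift of a vector field,
`X^c = ξ^i ∂/∂x^i + y^j (∂ξ^i/∂x^j) ∂/∂y^i`. -/
def vectorLift (X : (p : N) → TangentSpace I p) (y : TangentBundle I N) :
    TangentSpace I.tangent y :=
  ((vectorComponents I X y.proj (extChartAt I y.proj y.proj),
    fderivWithin ℝ (vectorComponents I X y.proj) (Set.range I) (extChartAt I y.proj y.proj) y.2) :
      E × E)

/-- The vertical lift of a covector field, i.e. its pullback by the projection. -/
def covectorVerticalLift (α : CovectorField I N) : CovectorField I.tangent (TangentBundle I N) :=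
  fun y => ((covectorComponents I α y.proj (extChartAt I y.proj y.proj)).comp
    (ContinuousLinearMap.fst ℝ E E) : E × E →L[ℝ] ℝ)

/-- The complete lift of a covector field,
`α^c = y^j (∂α_i/∂x^j) dx^i + α_i dy^i`. -/
def covectorLift (α : CovectorField I N) : CovectorField I.tangent (TangentBundle I N) :=
  fun y =>
    ((fderivWithin ℝ (covectorComponents I α y.proj) (Set.range I)
        (extChartAt I y.proj y.proj) y.2).comp (ContinuousLinearMap.fst ℝ E E)
      + (covectorComponents I α y.proj (extChartAt I y.proj y.proj)).comp
        (ContinuousLinearMap.snd ℝ E E) : E × E →L[ℝ] ℝ)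

/-- The complete lift of a tensor field of type `(0,2)`,
`σ^c = y^k (∂σ_ij/∂x^k) dx^i ⊗ dx^j + σ_ij dx^i ⊗ dy^j + σ_ij dy^i ⊗ dx^j`. -/
def bilinLift (σ : BilinField I N) : BilinField I.tangent (TangentBundle I N) :=
  fun y =>
    ((fderivWithin ℝ (bilinComponents I σ y.proj) (Set.range I)
        (extChartAt I y.proj y.proj) y.2).bilinearComp
        (ContinuousLinearMap.fst ℝ E E) (ContinuousLinearMap.fst ℝ E E)
      + (bilinComponents I σ y.proj (extChartAt I y.proj y.proj)).bilinearComp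
        (ContinuousLinearMap.fst ℝ E E) (ContinuousLinearMap.snd ℝ E E)
      + (bilinComponents I σ y.proj (extChartAt I y.proj y.proj)).bilinearComp
        (ContinuousLinearMap.snd ℝ E E) (ContinuousLinearMap.fst ℝ E E) :
      E × E →L[ℝ] E × E →L[ℝ] ℝ)

/-- The tensor product `α ⊗ β` of two covector fields. -/
def tensor (α β : CovectorField I N) : BilinField I N :=
  fun x => ((ContinuousLinearMap.mul ℝ ℝ).bilinearComp (α x : E →L[ℝ] ℝ) (β x : E →L[ℝ] ℝ) :
    E →L[ℝ] E →L[ℝ] ℝ)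

theorem fderivWithin_smulRight_apply {F : Type*} [NormedAddCommGroup F] [NormedSpace ℝ F]
    {a : E → E →L[ℝ] ℝ} {b : E → F} {s : Set E} {z : E} (ha : DifferentiableWithinAt ℝ a s z)
    (hb : DifferentiableWithinAt ℝ b s z) (hs : UniqueDiffWithinAt ℝ s z) (w : E) :
    fderivWithin ℝ (fun z => (a z).smulRight (b z)) s z w =
      (a z).smulRight (fderivWithin ℝ b s z w) + (fderivWithin ℝ a s z w).smulRight (b z) := by
  have h := (ContinuousLinearMap.smulRightL ℝ E F).fderivWithin_of_bilinear ha hb hs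
  exact congrArg (fun T => T w) h

/-- The rule `(α ⊗ β)^c = α^c ⊗ β^v + α^v ⊗ β^c` (for covector fields whose components are
differentiable), which, together with `ℝ`-linearity
and locality, characterizes the complete lift. -/
theorem bilinLift_tensor (α β : CovectorField I N) (y : TangentBundle I N)
    (hα : DifferentiableWithinAt ℝ (covectorComponents I α y.proj) (Set.range I)
      (extChartAt I y.proj y.proj))
    (hβ : DifferentiableWithinAt ℝ (covectorComponents I β y.proj) (Set.range I)
      (extChartAt I y.proj y.proj)) :
    bilinLift I (tensor I α β) y =
      tensor I.tangent (covectorLift I α) (covectorVerticalLift I β) y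
        + tensor I.tangent (covectorVerticalLift I α) (covectorLift I β) y := by
  have hu : UniqueDiffWithinAt ℝ (Set.range I) (extChartAt I y.proj y.proj) :=
    I.uniqueDiffOn _ (Set.mem_range_self _)
  have hT : bilinComponents I (tensor I α β) y.proj = fun z =>
      (covectorComponents I α y.proj z).smulRight (covectorComponents I β y.proj z) := by
    funext z
    ext u v
    rfl
  have hd := fderivWithin_smulRight_apply hα hβ hu y.2
  refine ContinuousLinearMap.ext fun U => ContinuousLinearMap.ext fun V => ?_
  unfold bilinLift
  rw [hT, hd]
  set a := covectorComponents I α y.proj (extChartAt I y.proj y.proj) with ha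
  set b := covectorComponents I β y.proj (extChartAt I y.proj y.proj) with hb
  set a' := fderivWithin ℝ (covectorComponents I α y.proj) (Set.range I)
    (extChartAt I y.proj y.proj) y.2 with ha'
  set b' := fderivWithin ℝ (covectorComponents I β y.proj) (Set.range I)
    (extChartAt I y.proj y.proj) y.2 with hb'
  change a U.1 * b' V.1 + a' U.1 * b V.1 + a U.1 * b V.2 + a U.2 * b V.1
    = (a' U.1 + a U.2) * b V.1 + a U.1 * (b' V.1 + b V.2)
  ring

/-- The differential of an action: the diffeomorphism `ρ g` acts on tangent vectors by its
differential. -/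
def actionLift {G : Type*} (ρ : G → N → N) (g : G) : TangentBundle I N → TangentBundle I N :=
  tangentMap I I (ρ g)

end CompleteLift

end AlmostSymplectic

end

/-! In natural coordinates `(z, w)` on the tangent bundle, a complete lift differentiates the
components of an object on the base in the direction `w`. An identity between smooth objects that
holds on an open set can be differentiated along `w`, and this, together with the identity itself,
yields the identity between the lifts. In this way `L_X σ = 0` gives `L_{X^c} σ^c = 0`
(`flatLie_lift_eq_zero`), and `i(X) σ = -df` gives `i(X^c) σ^c = -d(f^c)` (`flatLift_contraction`).
Non-degeneracy needs no differentiation: in the splitting into `dx` and `dy` components the matrix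
of `σ^c` has `σ` in both off-diagonal blocks and zero in the `dy`-`dy` block.

The lift is also natural: `(φ^* σ)^c = (Tφ)^* σ^c` (`flatLift_pullback`), because the second
derivatives of `φ` on the two sides agree by symmetry. For `φ` a change of charts this is the
independence of `σ^c` from the chart; for `φ` the coordinate expression of the transformation by a
group element it is the invariance of `σ^c` under the lifted action.

The infinitesimal transformations of the lifted action are the complete lifts of the original ones
(`infinitesimal_actionLift`), since derivatives in the group and in the base commute. Equivariance
of `Φ^c` is the chain rule, together with the linearity of `Ad*_g`.

All computations take place in normed spaces. The manifold part shows that components in the charts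
transform correctly, and that in a natural chart the components of a lift are the flat lift of the
components. -/

set_option synthInstance.maxHeartbeats 400000
set_option linter.unusedSectionVars false

noncomputable section

namespace AlmostSymplectic

/-! ### Complete lifts in a normed space -/

section Flat

variable {E : Type*} [NormedAddCommGroup E] [NormedSpace ℝ E]
  {F : Type*} [NormedAddCommGroup F] [NormedSpace ℝ F]

/-- The tangent map of a map between normed spaces. For a vector field, regarded as a map `E → E`,
this is also the coordinate expression of the complete lift. -/
def flatTangent (φ : E → F) (p : E × E) : F × F :=
  (φ p.1, fderiv ℝ φ p.1 p.2)

/-- The complete lift of a field of bilinear forms on a normed space. -/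
def flatLift (s : E → E →L[ℝ] E →L[ℝ] ℝ) (p : E × E) : E × E →L[ℝ] E × E →L[ℝ] ℝ :=
  (fderiv ℝ s p.1 p.2).bilinearComp (ContinuousLinearMap.fst ℝ E E) (ContinuousLinearMap.fst ℝ E E)
    + (s p.1).bilinearComp (ContinuousLinearMap.fst ℝ E E) (ContinuousLinearMap.snd ℝ E E)
    + (s p.1).bilinearComp (ContinuousLinearMap.snd ℝ E E) (ContinuousLinearMap.fst ℝ E E)

/-- The Lie derivative of a field of bilinear forms on a normed space. -/
def flatLie (s : E → E →L[ℝ] E →L[ℝ] ℝ) (ξ : E → E) (z u v : E) : ℝ :=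
  fderiv ℝ s z (ξ z) u v + s z (fderiv ℝ ξ z u) v + s z u (fderiv ℝ ξ z v)

theorem flatLift_apply (s : E → E →L[ℝ] E →L[ℝ] ℝ) (p U V : E × E) :
    flatLift s p U V = fderiv ℝ s p.1 p.2 U.1 V.1 + s p.1 U.1 V.2 + s p.1 U.2 V.1 := rfl

theorem _root_.ContDiffAt.fderiv_infty {f : E → F} {z : E} (hf : ContDiffAt ℝ ∞ f z) :
    ContDiffAt ℝ ∞ (fderiv ℝ f) z :=
  hf.fderiv_right (by simp)

theorem _root_.ContDiffAt.hasFDerivAt_infty {f : E → F} {z : E} (hf : ContDiffAt ℝ ∞ f z) :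
    HasFDerivAt f (fderiv ℝ f z) z :=
  (hf.differentiableAt (by simp)).hasFDerivAt

theorem _root_.ContDiffAt.fderiv_fderiv_comm {f : E → F} {z : E} (hf : ContDiffAt ℝ ∞ f z)
    (u v : E) : fderiv ℝ (fderiv ℝ f) z u v = fderiv ℝ (fderiv ℝ f) z v u :=
  hf.isSymmSndFDerivAt (by simpa using ENat.LEInfty.out) u v

/-- Product rule for `(z, w) ↦ Df(z) w`, the coordinate form of `f^c`; every derivative of a lift
below reduces to it. -/
theorem fderiv_fderiv_apply_snd {f : E → F} {p : E × E} (hf : ContDiffAt ℝ ∞ f p.1) :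
    HasFDerivAt (fun q : E × E => fderiv ℝ f q.1 q.2)
      ((fderiv ℝ f p.1).comp (ContinuousLinearMap.snd ℝ E E)
        + ((fderiv ℝ (fderiv ℝ f) p.1).comp (ContinuousLinearMap.fst ℝ E E)).flip p.2) p := by
  have h1 : HasFDerivAt (fun q : E × E => fderiv ℝ f q.1)
      ((fderiv ℝ (fderiv ℝ f) p.1).comp (ContinuousLinearMap.fst ℝ E E)) p :=
    hf.fderiv_infty.hasFDerivAt_infty.comp p hasFDerivAt_fst
  exact h1.clm_apply hasFDerivAt_snd

theorem fderiv_flatTangent {φ : E → F} {p : E × E} (hφ : ContDiffAt ℝ ∞ φ p.1) (U : E × E) :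
    fderiv ℝ (flatTangent φ) p U =
      (fderiv ℝ φ p.1 U.1, fderiv ℝ φ p.1 U.2 + fderiv ℝ (fderiv ℝ φ) p.1 U.1 p.2) := by
  have h1 : HasFDerivAt (fun q : E × E => φ q.1)
      ((fderiv ℝ φ p.1).comp (ContinuousLinearMap.fst ℝ E E)) p :=
    hφ.hasFDerivAt_infty.comp p hasFDerivAt_fst
  have h := h1.prodMk (fderiv_fderiv_apply_snd hφ)
  have h' : HasFDerivAt (flatTangent φ) _ p := h
  rw [h'.fderiv]
  rfl

theorem contDiffAt_flatTangent {φ : E → F} {p : E × E} (hφ : ContDiffAt ℝ ∞ φ p.1) :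
    ContDiffAt ℝ ∞ (flatTangent φ) p :=
  (hφ.comp p contDiffAt_fst).prodMk ((hφ.fderiv_infty.comp p contDiffAt_fst).clm_apply
    contDiffAt_snd)

theorem contDiffAt_flatLift {s : E → E →L[ℝ] E →L[ℝ] ℝ} {p : E × E}
    (hs : ContDiffAt ℝ ∞ s p.1) : ContDiffAt ℝ ∞ (flatLift s) p := by
  have h1 : ContDiffAt ℝ ∞ (fun q : E × E => s q.1) p := hs.comp p contDiffAt_fst
  have h2 : ContDiffAt ℝ ∞ (fun q : E × E => fderiv ℝ s q.1 q.2) p :=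
    (hs.fderiv_infty.comp p contDiffAt_fst).clm_apply contDiffAt_snd
  have hb : ∀ (A B : E × E →L[ℝ] E) {t : E × E → E →L[ℝ] E →L[ℝ] ℝ}, ContDiffAt ℝ ∞ t p →
      ContDiffAt ℝ ∞ (fun q => (t q).bilinearComp A B) p := by
    intro A B t ht
    have h3 : ContDiffAt ℝ ∞ (fun q => ((ContinuousLinearMap.compL ℝ (E × E) E ℝ).flip B).comp
        ((t q).comp A)) p := contDiffAt_const.clm_comp (ht.clm_comp contDiffAt_const)
    exact h3
  exact ((hb _ _ h2).add (hb _ _ h1)).add (hb _ _ h1)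

theorem fderiv_bilin_apply {G : Type*} [NormedAddCommGroup G] [NormedSpace ℝ G]
    {t : G → E →L[ℝ] E →L[ℝ] ℝ} {a b : G → E} {z : G}
    {t' : G →L[ℝ] E →L[ℝ] E →L[ℝ] ℝ} {a' b' : G →L[ℝ] E} (ht : HasFDerivAt t t' z)
    (ha : HasFDerivAt a a' z) (hb : HasFDerivAt b b' z) (w : G) :
    fderiv ℝ (fun q => t q (a q) (b q)) z w =
      t' w (a z) (b z) + t z (a' w) (b z) + t z (a z) (b' w) := by
  rw [((ht.clm_apply ha).clm_apply hb).fderiv]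
  simp
  ring

theorem fderiv_bilin_const {G : Type*} [NormedAddCommGroup G] [NormedSpace ℝ G]
    {t : G → E →L[ℝ] E →L[ℝ] ℝ} {z : G} (ht : DifferentiableAt ℝ t z) (w : G) (u v : E) :
    fderiv ℝ (fun q => t q u v) z w = fderiv ℝ t z w u v := by
  simpa using fderiv_bilin_apply ht.hasFDerivAt (hasFDerivAt_const u z)
    (hasFDerivAt_const v z) w

theorem contDiffAt_bilin_const {s : E → E →L[ℝ] E →L[ℝ] ℝ} {z : E} (hs : ContDiffAt ℝ ∞ s z)
    (u v : E) : ContDiffAt ℝ ∞ (fun q => s q u v) z :=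
  (hs.clm_apply contDiffAt_const).clm_apply contDiffAt_const

/-- The identity is needed on a whole neighbourhood because both sides are differentiated once more.
-/
theorem eventually_fderiv_bilin_const {s : E → E →L[ℝ] E →L[ℝ] ℝ} {z : E}
    (hs : ContDiffAt ℝ ∞ s z) (u v : E) :
    ∀ᶠ q in 𝓝 z, ∀ w, fderiv ℝ s q w u v = fderiv ℝ (fun q => s q u v) q w := by
  have h1 : ContDiffAt ℝ 1 s z := hs.of_le (by simp)
  filter_upwards [h1.eventually (by simp)] with q hq w
  rw [fderiv_bilin_const (hq.differentiableAt (by simp))]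

/-- The second derivative of `s` enters as the Hessian of the scalar coefficient with `U.1`, `V.1`
frozen, so that its symmetry is that of a scalar function. -/
theorem fderiv_flatLift {s : E → E →L[ℝ] E →L[ℝ] ℝ} {p : E × E}
    (hs : ContDiffAt ℝ ∞ s p.1) (W U V : E × E) :
    fderiv ℝ (flatLift s) p W U V =
      fderiv ℝ (fderiv ℝ (fun q => s q U.1 V.1)) p.1 W.1 p.2 + fderiv ℝ s p.1 W.2 U.1 V.1
        + fderiv ℝ s p.1 W.1 U.1 V.2 + fderiv ℝ s p.1 W.1 U.2 V.1 := by
  rw [← fderiv_bilin_const ((contDiffAt_flatLift hs).differentiableAt (by simp))]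
  have he : (fun q => flatLift s q U V) =ᶠ[𝓝 p] fun q =>
      fderiv ℝ (fun q => s q U.1 V.1) q.1 q.2 + s q.1 U.1 V.2 + s q.1 U.2 V.1 := by
    filter_upwards [continuousAt_fst.eventually (eventually_fderiv_bilin_const hs U.1 V.1)]
      with q hq
    rw [flatLift_apply, hq]
  have h1 : ∀ u v : E, HasFDerivAt (fun q : E × E => s q.1 u v)
      ((fderiv ℝ (fun q => s q u v) p.1).comp (ContinuousLinearMap.fst ℝ E E)) p := fun u v =>
    (contDiffAt_bilin_const hs u v).hasFDerivAt_infty.comp p hasFDerivAt_fst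
  have h2 := fderiv_fderiv_apply_snd (contDiffAt_bilin_const hs U.1 V.1)
  have hc := fun u v => (eventually_fderiv_bilin_const hs u v).self_of_nhds
  rw [he.fderiv_eq, ((h2.fun_add (h1 _ _)).fun_add (h1 _ _)).fderiv, hc, hc, hc]
  simp
  ring

/-- The pullback of a field of bilinear forms. -/
def flatPullback (φ : E → F) (s : F → F →L[ℝ] F →L[ℝ] ℝ) (z : E) : E →L[ℝ] E →L[ℝ] ℝ :=
  (s (φ z)).bilinearComp (fderiv ℝ φ z) (fderiv ℝ φ z)

theorem fderiv_flatPullback {φ : E → F} {s : F → F →L[ℝ] F →L[ℝ] ℝ}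
    {t : E → E →L[ℝ] E →L[ℝ] ℝ} {z : E}
    (hφ : ContDiffAt ℝ ∞ φ z) (hs : ContDiffAt ℝ ∞ s (φ z)) (ht : DifferentiableAt ℝ t z)
    (hst : t =ᶠ[𝓝 z] flatPullback φ s) (w u v : E) :
    fderiv ℝ t z w u v =
      fderiv ℝ s (φ z) (fderiv ℝ φ z w) (fderiv ℝ φ z u) (fderiv ℝ φ z v)
        + s (φ z) (fderiv ℝ (fderiv ℝ φ) z w u) (fderiv ℝ φ z v)
        + s (φ z) (fderiv ℝ φ z u) (fderiv ℝ (fderiv ℝ φ) z w v) := by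
  have hd := hφ.fderiv_infty.hasFDerivAt_infty
  have hc : ∀ u : E, HasFDerivAt (fun z' => fderiv ℝ φ z' u)
      ((fderiv ℝ (fderiv ℝ φ) z).flip u) z := by
    intro u
    convert hd.clm_apply (hasFDerivAt_const u z) using 1
    ext; simp
  have hsφ : HasFDerivAt (fun z' => s (φ z')) _ z :=
    hs.hasFDerivAt_infty.comp z hφ.hasFDerivAt_infty
  rw [← fderiv_bilin_const ht]
  have he : (fun q => t q u v) =ᶠ[𝓝 z] fun q => s (φ q) (fderiv ℝ φ q u) (fderiv ℝ φ q v) :=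
    hst.mono fun q hq => by simp only [hq]; rfl
  rw [he.fderiv_eq]
  exact fderiv_bilin_apply hsφ (hc u) (hc v) w

/-- The complete lift of bilinear forms commutes with pullbacks. -/
theorem flatLift_pullback {φ : E → F} {s : F → F →L[ℝ] F →L[ℝ] ℝ}
    {t : E → E →L[ℝ] E →L[ℝ] ℝ} {p : E × E}
    (hφ : ContDiffAt ℝ ∞ φ p.1) (hs : ContDiffAt ℝ ∞ s (φ p.1)) (ht : DifferentiableAt ℝ t p.1)
    (hst : t =ᶠ[𝓝 p.1] flatPullback φ s) (U V : E × E) :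
    flatLift t p U V =
      flatLift s (flatTangent φ p) (fderiv ℝ (flatTangent φ) p U)
        (fderiv ℝ (flatTangent φ) p V) := by
  have h0 : ∀ u v, t p.1 u v = s (φ p.1) (fderiv ℝ φ p.1 u) (fderiv ℝ φ p.1 v) := by
    intro u v; rw [hst.self_of_nhds]; rfl
  -- On the left the second derivatives of `φ` come from differentiating the pullback along `p.2`,
  -- on the right from the fibre components of the tangent map; symmetry makes them equal.
  rw [flatLift_apply, flatLift_apply, fderiv_flatPullback hφ hs ht hst, fderiv_flatTangent hφ,
    fderiv_flatTangent hφ, h0, h0, hφ.fderiv_fderiv_comm U.1, hφ.fderiv_fderiv_comm V.1]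
  simp only [flatTangent, map_add, add_apply]
  ring

/-- The Lie derivative commutes with pullbacks. -/
theorem flatLie_pullback {φ : E → F} {s : F → F →L[ℝ] F →L[ℝ] ℝ}
    {t : E → E →L[ℝ] E →L[ℝ] ℝ} {ξ : E → E} {η : F → F} {z : E}
    (hφ : ContDiffAt ℝ ∞ φ z) (hs : ContDiffAt ℝ ∞ s (φ z)) (ht : DifferentiableAt ℝ t z)
    (hξ : ContDiffAt ℝ ∞ ξ z) (hη : ContDiffAt ℝ ∞ η (φ z))
    (hst : t =ᶠ[𝓝 z] flatPullback φ s)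
    (hξη : ∀ᶠ z' in 𝓝 z, fderiv ℝ φ z' (ξ z') = η (φ z')) (u v : E) :
    flatLie t ξ z u v = flatLie s η (φ z) (fderiv ℝ φ z u) (fderiv ℝ φ z v) := by
  have h0 : ∀ u v, t z u v = s (φ z) (fderiv ℝ φ z u) (fderiv ℝ φ z v) := by
    intro u v; rw [hst.self_of_nhds]; rfl
  -- Differentiating the relation `Dφ(ξ) = η ∘ φ` produces a second derivative of `φ`, which matches
  -- the one from the pullback.
  have h1 : ∀ w, fderiv ℝ η (φ z) (fderiv ℝ φ z w) =
      fderiv ℝ φ z (fderiv ℝ ξ z w) + fderiv ℝ (fderiv ℝ φ) z w (ξ z) := by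
    intro w
    have e1 : fderiv ℝ (fun z' => fderiv ℝ φ z' (ξ z')) z = fderiv ℝ (fun z' => η (φ z')) z :=
      Filter.EventuallyEq.fderiv_eq hξη
    rw [(hφ.fderiv_infty.hasFDerivAt_infty.clm_apply hξ.hasFDerivAt_infty).fderiv,
      (show HasFDerivAt (fun z' => η (φ z')) _ z from
        hη.hasFDerivAt_infty.comp z hφ.hasFDerivAt_infty).fderiv] at e1
    have := congrArg (fun T => T w) e1
    simpa using this.symm
  unfold flatLie
  rw [fderiv_flatPullback hφ hs ht hst, h0, h0, h1, h1, hξη.self_of_nhds,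
    hφ.fderiv_fderiv_comm u, hφ.fderiv_fderiv_comm v]
  simp only [map_add, add_apply]
  ring

/-- If a Lie derivative vanishes, so does that of the complete lifts. -/
theorem flatLie_lift_eq_zero {s : E → E →L[ℝ] E →L[ℝ] ℝ} {ξ : E → E} {p : E × E}
    (hs : ContDiffAt ℝ ∞ s p.1) (hξ : ContDiffAt ℝ ∞ ξ p.1)
    (h : ∀ᶠ z in 𝓝 p.1, ∀ u v, flatLie s ξ z u v = 0) (U V : E × E) :
    flatLie (flatLift s) (flatTangent ξ) p U V = 0 := by
  have h0 := h.self_of_nhds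
  -- The Lie derivative of the lifts is the complete lift of `flatLie s ξ`: its derivative along
  -- `p.2` on `(U.1, V.1)`, plus its values on `(U.1, V.2)` and `(U.2, V.1)`. The three summands
  -- vanish by `hD`, `h1` and `h2`.
  have hD : fderiv ℝ (fun z => flatLie s ξ z U.1 V.1) p.1 p.2 = 0 := by
    have : (fun z => flatLie s ξ z U.1 V.1) =ᶠ[𝓝 p.1] fun _ => 0 := h.mono fun z hz => hz _ _
    rw [this.fderiv_eq]; simp
  have hξ' : ∀ u : E, HasFDerivAt (fun z' => fderiv ℝ ξ z' u)
      ((fderiv ℝ (fderiv ℝ ξ) p.1).flip u) p.1 := by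
    intro u
    convert hξ.fderiv_infty.hasFDerivAt_infty.clm_apply (hasFDerivAt_const u p.1) using 1
    ext; simp
  have hcst : ∀ u : E, HasFDerivAt (fun _ : E => u) (0 : E →L[ℝ] E) p.1 := fun u =>
    hasFDerivAt_const u p.1
  have hg := contDiffAt_bilin_const hs U.1 V.1
  have he : (fun z => flatLie s ξ z U.1 V.1) =ᶠ[𝓝 p.1] fun z =>
      fderiv ℝ (fun q => s q U.1 V.1) z (ξ z) + (s z (fderiv ℝ ξ z U.1) V.1
        + s z U.1 (fderiv ℝ ξ z V.1)) := by
    filter_upwards [eventually_fderiv_bilin_const hs U.1 V.1] with z hz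
    rw [flatLie, hz, add_assoc]
  have d1 := hg.fderiv_infty.hasFDerivAt_infty.clm_apply hξ.hasFDerivAt_infty
  have d2 := (hs.hasFDerivAt_infty.clm_apply (hξ' U.1)).clm_apply (hcst V.1)
  have d3 := (hs.hasFDerivAt_infty.clm_apply (hcst U.1)).clm_apply (hξ' V.1)
  have hc := fun u v => (eventually_fderiv_bilin_const hs u v).self_of_nhds
  rw [he.fderiv_eq,
    fderiv_fun_add d1.differentiableAt (d2.differentiableAt.fun_add d3.differentiableAt),
    fderiv_fun_add d2.differentiableAt d3.differentiableAt, d1.fderiv, add_apply, add_apply,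
    add_apply,
    fderiv_bilin_apply hs.hasFDerivAt_infty (hξ' U.1) (hcst V.1),
    fderiv_bilin_apply hs.hasFDerivAt_infty (hcst U.1) (hξ' V.1)] at hD
  simp only [ContinuousLinearMap.comp_apply, ContinuousLinearMap.flip_apply,
    zero_apply, map_zero, add_zero, ← hc] at hD
  have h1 := h0 U.1 V.2
  have h2 := h0 U.2 V.1
  unfold flatLie at h1 h2 ⊢
  rw [fderiv_flatLift hs, flatLift_apply, flatLift_apply, fderiv_flatTangent hξ,
    fderiv_flatTangent hξ, hg.fderiv_fderiv_comm, hξ.fderiv_fderiv_comm U.1,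
    hξ.fderiv_fderiv_comm V.1]
  simp only [flatTangent, map_add, add_apply]
  linarith

/-- The `dx` part is the hypothesis differentiated along `p.2`, with the Hessian of `f` symmetrized;
the `dy` part is the hypothesis itself. -/
theorem flatLift_contraction {s : E → E →L[ℝ] E →L[ℝ] ℝ} {ξ : E → E} {f : E → ℝ} {p : E × E}
    (hs : ContDiffAt ℝ ∞ s p.1) (hξ : ContDiffAt ℝ ∞ ξ p.1) (hf : ContDiffAt ℝ ∞ f p.1)
    (h : ∀ᶠ z in 𝓝 p.1, ∀ v, s z (ξ z) v = - fderiv ℝ f z v) (V : E × E) :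
    flatLift s p (flatTangent ξ p) V = - fderiv ℝ (fun q : E × E => fderiv ℝ f q.1 q.2) p V := by
  have h0 := h.self_of_nhds
  have e1 : fderiv ℝ (fun z => s z (ξ z) V.1) p.1 p.2 =
      fderiv ℝ (fun z => -fderiv ℝ f z V.1) p.1 p.2 := by
    rw [Filter.EventuallyEq.fderiv_eq (h.mono fun z hz => hz V.1)]
  rw [fderiv_bilin_apply hs.hasFDerivAt_infty hξ.hasFDerivAt_infty
    (hasFDerivAt_const V.1 p.1), fderiv_fun_neg,
    (hf.fderiv_infty.hasFDerivAt_infty.clm_apply (hasFDerivAt_const V.1 p.1)).fderiv] at e1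
  rw [(fderiv_fderiv_apply_snd hf).fderiv, flatLift_apply]
  simp only [flatTangent]
  rw [h0]
  simp at e1 ⊢
  rw [hf.fderiv_fderiv_comm V.1]
  linarith

theorem flatLift_skew {s : E → E →L[ℝ] E →L[ℝ] ℝ} {p : E × E} (hs : ContDiffAt ℝ ∞ s p.1)
    (h : ∀ᶠ z in 𝓝 p.1, ∀ u v, s z u v = - s z v u) (U V : E × E) :
    flatLift s p U V = - flatLift s p V U := by
  have h0 := h.self_of_nhds
  have hd := hs.differentiableAt (by simp : (∞ : WithTop ℕ∞) ≠ 0)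
  have e1 : fderiv ℝ s p.1 p.2 U.1 V.1 = - fderiv ℝ s p.1 p.2 V.1 U.1 := by
    rw [← fderiv_bilin_const hd, ← fderiv_bilin_const hd,
      Filter.EventuallyEq.fderiv_eq (h.mono fun z hz => hz U.1 V.1), fderiv_fun_neg]
    rfl
  rw [flatLift_apply, flatLift_apply, e1, h0 U.1, h0 U.2]
  ring

/-- Vertical test vectors `(0, v)` see only `s U.1 v`, which forces `U.1 = 0`; then `(v, 0)` sees
only `s U.2 v`. -/
theorem flatLift_nondegenerate {s : E → E →L[ℝ] E →L[ℝ] ℝ} {p : E × E}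
    (h : ∀ u, (∀ v, s p.1 u v = 0) → u = 0) (U : E × E) (hU : ∀ V, flatLift s p U V = 0) :
    U = 0 := by
  have h1 : U.1 = 0 := h _ fun v => by simpa [flatLift_apply] using hU (0, v)
  have h2 : U.2 = 0 := h _ fun v => by simpa [flatLift_apply, h1] using hU (v, 0)
  exact Prod.ext h1 h2

end Flat

/-! ### Coordinate expressions -/

section Charts

variable {E : Type*} [NormedAddCommGroup E] [NormedSpace ℝ E]
  {H : Type*} [TopologicalSpace H] {I : ModelWithCorners ℝ E H} [I.Boundaryless]
  {M : Type*} [TopologicalSpace M] [ChartedSpace H M] [IsManifold I ∞ M]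
  {E' : Type*} [NormedAddCommGroup E'] [NormedSpace ℝ E']
  {H' : Type*} [TopologicalSpace H'] {I' : ModelWithCorners ℝ E' H'} [I'.Boundaryless]
  {M' : Type*} [TopologicalSpace M'] [ChartedSpace H' M'] [IsManifold I' ∞ M']

/-- A tangent vector at `p` is recorded by its components in the preferred chart at `p`, so the
differential of another chart is a coordinate change. This turns all differentials of charts into
`tangentCoordChange`, with its cocycle rules. -/
theorem mfderiv_extChartAt_eq {x p : M} (hp : p ∈ (extChartAt I x).source) :
    (mfderiv I 𝓘(ℝ, E) (extChartAt I x) p : E →L[ℝ] E) = tangentCoordChange I p x p := by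
  rw [extChartAt_source] at hp
  exact (TangentBundle.continuousLinearMapAt_trivializationAt hp).symm.trans
    (TangentBundle.continuousLinearMapAt_trivializationAt_eq_core hp)

theorem mfderivWithin_extChartAt_symm_eq {x p : M} (hp : p ∈ (extChartAt I x).source) :
    (mfderivWithin 𝓘(ℝ, E) I (extChartAt I x).symm (Set.range I) (extChartAt I x p) : E →L[ℝ] E)
      = tangentCoordChange I x p p := by
  rw [extChartAt_source] at hp
  exact (TangentBundle.symmL_trivializationAt hp).symm.trans
    (TangentBundle.symmL_trivializationAt_eq_core hp)

theorem frame_eq {x : M} {z : E} (hz : z ∈ (extChartAt I x).target) :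
    (frame I x z : E →L[ℝ] E) =
      tangentCoordChange I x ((extChartAt I x).symm z) ((extChartAt I x).symm z) := by
  have h := mfderivWithin_extChartAt_symm_eq ((extChartAt I x).map_target hz)
  rw [(extChartAt I x).right_inv hz] at h
  exact h

theorem bilinComponents_apply (Ω : BilinField I M) {x : M} {z : E}
    (hz : z ∈ (extChartAt I x).target) (u v : E) :
    bilinComponents I Ω x z u v = (Ω ((extChartAt I x).symm z) : E →L[ℝ] E →L[ℝ] ℝ)
      (tangentCoordChange I x ((extChartAt I x).symm z) ((extChartAt I x).symm z) u)
      (tangentCoordChange I x ((extChartAt I x).symm z) ((extChartAt I x).symm z) v) := by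
  rw [← frame_eq hz]
  rfl

theorem vectorComponents_eq (X : (p : M) → TangentSpace I p) {x : M} {z : E}
    (hz : z ∈ (extChartAt I x).target) :
    vectorComponents I X x z = tangentCoordChange I ((extChartAt I x).symm z) x
      ((extChartAt I x).symm z) (X ((extChartAt I x).symm z) : E) := by
  rw [← mfderiv_extChartAt_eq ((extChartAt I x).map_target hz)]
  rfl

theorem tangentCoordChange_symm_apply {x p : M} (hp : p ∈ (extChartAt I x).source) (v : E) :
    tangentCoordChange I x p p (tangentCoordChange I p x p v) = v := by
  rw [tangentCoordChange_comp ⟨⟨mem_extChartAt_source p, hp⟩, mem_extChartAt_source p⟩,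
    tangentCoordChange_self (mem_extChartAt_source p)]

theorem tangentCoordChange_apply_symm {x p : M} (hp : p ∈ (extChartAt I x).source) (v : E) :
    tangentCoordChange I p x p (tangentCoordChange I x p p v) = v := by
  rw [tangentCoordChange_comp ⟨⟨hp, mem_extChartAt_source p⟩, hp⟩, tangentCoordChange_self hp]

theorem fderiv_transition {x₀ x₁ p : M} (h₀ : p ∈ (extChartAt I x₀).source)
    (h₁ : p ∈ (extChartAt I x₁).source) :
    fderiv ℝ (extChartAt I x₁ ∘ (extChartAt I x₀).symm) (extChartAt I x₀ p) =
      tangentCoordChange I x₀ x₁ p := by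
  have h := hasFDerivWithinAt_tangentCoordChange (I := I) ⟨h₀, h₁⟩
  rw [I.range_eq_univ, hasFDerivWithinAt_univ] at h
  exact h.fderiv

theorem hasMFDerivAt_extChartAt_symm {x p : M} (hp : p ∈ (extChartAt I x).source) :
    HasMFDerivAt 𝓘(ℝ, E) I (extChartAt I x).symm (extChartAt I x p)
      (tangentCoordChange I x p p : E →L[ℝ] E) := by
  have h := (mdifferentiableWithinAt_extChartAt_symm
    ((extChartAt I x).map_source hp)).hasMFDerivWithinAt
  rw [I.range_eq_univ, hasMFDerivWithinAt_univ] at h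
  have e := mfderivWithin_extChartAt_symm_eq hp
  rw [I.range_eq_univ] at e
  rw [← e]
  exact h

theorem hasMFDerivAt_extChartAt' {x p : M} (hp : p ∈ (extChartAt I x).source) :
    HasMFDerivAt I 𝓘(ℝ, E) (extChartAt I x) p (tangentCoordChange I p x p : E →L[ℝ] E) := by
  rw [← mfderiv_extChartAt_eq hp]
  exact (mdifferentiableAt_extChartAt (by rwa [extChartAt_source] at hp)).hasMFDerivAt

/-- The derivative of the coordinate expression of a map between manifolds. -/
theorem fderiv_chartExpression {F : M → M'} {x₀ p : M} {x₁ : M'}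
    (hF : MDifferentiableAt I I' F p) (h₀ : p ∈ (extChartAt I x₀).source)
    (h₁ : F p ∈ (extChartAt I' x₁).source) (u : E) :
    fderiv ℝ (extChartAt I' x₁ ∘ F ∘ (extChartAt I x₀).symm) (extChartAt I x₀ p) u =
      tangentCoordChange I' (F p) x₁ (F p)
        ((mfderiv I I' F p : E →L[ℝ] E') (tangentCoordChange I x₀ p p u)) := by
  have hp := (extChartAt I x₀).left_inv h₀
  set A : E →L[ℝ] E' := mfderiv I I' F p with hA
  have a1 := hasMFDerivAt_extChartAt_symm h₀
  have a2 : HasMFDerivAt I I' F ((extChartAt I x₀).symm (extChartAt I x₀ p)) A := by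
    rw [hp]; exact hF.hasMFDerivAt
  have a3 : HasMFDerivAt I' 𝓘(ℝ, E') (extChartAt I' x₁)
      ((F ∘ (extChartAt I x₀).symm) (extChartAt I x₀ p))
      (tangentCoordChange I' (F p) x₁ (F p) : E' →L[ℝ] E') := by
    rw [Function.comp_apply, hp]; exact hasMFDerivAt_extChartAt' h₁
  have a4 : HasFDerivAt (extChartAt I' x₁ ∘ F ∘ (extChartAt I x₀).symm)
      ((tangentCoordChange I' (F p) x₁ (F p)).comp (A.comp (tangentCoordChange I x₀ p p)))
      (extChartAt I x₀ p) := (a3.comp _ (a2.comp _ a1)).hasFDerivAt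
  rw [a4.fderiv]
  rfl

/-- The derivative of the coordinate expression of a vector-valued function. -/
theorem fderiv_functionExpression {f : M → E'} {x₀ p : M}
    (hf : MDifferentiableAt I 𝓘(ℝ, E') f p) (h₀ : p ∈ (extChartAt I x₀).source) (u : E) :
    fderiv ℝ (f ∘ (extChartAt I x₀).symm) (extChartAt I x₀ p) u =
      (mvfderiv I f p : E →L[ℝ] E') (tangentCoordChange I x₀ p p u) := by
  have hp := (extChartAt I x₀).left_inv h₀
  set A : E →L[ℝ] E' := mvfderiv I f p with hA
  have a1 := hasMFDerivAt_extChartAt_symm h₀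
  have a2 : HasMFDerivAt I 𝓘(ℝ, E') f ((extChartAt I x₀).symm (extChartAt I x₀ p)) A := by
    rw [hp]; exact hf.hasMFDerivAt
  have a4 : HasFDerivAt (f ∘ (extChartAt I x₀).symm) (A.comp (tangentCoordChange I x₀ p p))
      (extChartAt I x₀ p) := (a2.comp _ a1).hasFDerivAt
  rw [a4.fderiv]
  rfl

theorem contDiffAt_chartExpression {F : M → M'} {x₀ p : M} {x₁ : M'}
    (hF : ContMDiffAt I I' ∞ F p) (h₀ : p ∈ (extChartAt I x₀).source)
    (h₁ : F p ∈ (extChartAt I' x₁).source) :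
    ContDiffAt ℝ ∞ (extChartAt I' x₁ ∘ F ∘ (extChartAt I x₀).symm) (extChartAt I x₀ p) := by
  have h := (contMDiffAt_iff_of_mem_source (by rwa [extChartAt_source] at h₀)
    (by rwa [extChartAt_source] at h₁)).1 hF
  rw [I.range_eq_univ, contDiffWithinAt_univ] at h
  exact h.2

theorem contDiffAt_transition {x₀ x₁ p : M} (h₀ : p ∈ (extChartAt I x₀).source)
    (h₁ : p ∈ (extChartAt I x₁).source) :
    ContDiffAt ℝ ∞ (extChartAt I x₁ ∘ (extChartAt I x₀).symm) (extChartAt I x₀ p) :=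
  contDiffAt_chartExpression (F := id) contMDiffAt_id h₀ h₁

theorem contDiffAt_functionExpression {f : M → E'} {x₀ p : M}
    (hf : ContMDiffAt I 𝓘(ℝ, E') ∞ f p) (h₀ : p ∈ (extChartAt I x₀).source) :
    ContDiffAt ℝ ∞ (f ∘ (extChartAt I x₀).symm) (extChartAt I x₀ p) := by
  have h := contDiffAt_chartExpression (x₁ := f p) hf h₀ (by simp)
  rwa [extChartAt_model_space_eq_id] at h

/-! ### The natural charts of the tangent bundle -/

theorem extChartAt_tangent_self (y : TangentBundle I M) :
    extChartAt I.tangent y y = (extChartAt I y.proj y.proj, (y.2 : E)) := by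
  exact Prod.ext rfl (tangentCoordChange_self (mem_extChartAt_source _))

theorem mem_extChartAt_tangent_source {y q : TangentBundle I M} :
    q ∈ (extChartAt I.tangent y).source ↔ q.proj ∈ (extChartAt I y.proj).source := by
  rw [extChartAt_source, extChartAt_source]
  exact TangentBundle.mem_chart_source_iff q y

theorem mem_extChartAt_tangent_target {y : TangentBundle I M} {p : E × E} :
    p ∈ (extChartAt I.tangent y).target ↔ p.1 ∈ (extChartAt I y.proj).target := by
  rw [extChartAt_target, extChartAt_target, I.range_eq_univ, I.tangent.range_eq_univ,
    Set.inter_univ, Set.inter_univ]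
  exact TangentBundle.mem_chart_target_iff _ y

theorem extChartAt_tangent_symm {y : TangentBundle I M} {z : E} (w : E)
    (hz : z ∈ (extChartAt I y.proj).target) :
    (extChartAt I.tangent y).symm (z, w) = ⟨(extChartAt I y.proj).symm z,
      tangentCoordChange I y.proj ((extChartAt I y.proj).symm z)
        ((extChartAt I y.proj).symm z) w⟩ := by
  have hs := (extChartAt I y.proj).map_target hz
  refine (PartialEquiv.symm_apply_eq _ (mem_extChartAt_tangent_source.2 hs)
    (mem_extChartAt_tangent_target.2 hz)).2 ?_
  refine Prod.ext ((extChartAt I y.proj).right_inv hz).symm ?_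
  exact (tangentCoordChange_apply_symm hs w).symm

end Charts

/-! ### Smoothness of tensor fields in terms of their components -/

section Smoothness

variable {E : Type*} [NormedAddCommGroup E] [NormedSpace ℝ E]
  {H : Type*} [TopologicalSpace H] {I : ModelWithCorners ℝ E H} [I.Boundaryless]
  {M : Type*} [TopologicalSpace M] [ChartedSpace H M] [IsManifold I ∞ M]
  {E' : Type*} [NormedAddCommGroup E'] [NormedSpace ℝ E']

/-- A function that agrees near `p` with the pullback of `g` by a chart is smooth at `p` if and only
if `g` is smooth at the corresponding point. -/
theorem contMDiffAt_iff_contDiffAt_of_comp {h : M → E'} {g : E → E'} {x p : M}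
    (hp : p ∈ (extChartAt I x).source)
    (hg : ∀ q ∈ (extChartAt I x).source, h q = g (extChartAt I x q)) :
    ContMDiffAt I 𝓘(ℝ, E') ∞ h p ↔ ContDiffAt ℝ ∞ g (extChartAt I x p) := by
  constructor
  · intro hh
    refine (contDiffAt_functionExpression hh hp).congr_of_eventuallyEq ?_
    filter_upwards [(isOpen_extChartAt_target x).mem_nhds ((extChartAt I x).map_source hp)]
      with z hz
    rw [Function.comp_apply, hg _ ((extChartAt I x).map_target hz), (extChartAt I x).right_inv hz]
  · intro hh
    have h1 : ContMDiffAt I 𝓘(ℝ, E) ∞ (extChartAt I x) p :=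
      contMDiffAt_extChartAt' (by rwa [extChartAt_source] at hp)
    refine (hh.contMDiffAt.comp p h1).congr_of_eventuallyEq ?_
    filter_upwards [(isOpen_extChartAt_source x).mem_nhds hp] with q hq
    exact hg q hq

theorem contMDiffAt_vectorField_iff {X : (p : M) → TangentSpace I p} {x p : M}
    (hp : p ∈ (extChartAt I x).source) :
    ContMDiffAt I I.tangent ∞ (fun q : M => (⟨q, X q⟩ : TangentBundle I M)) p ↔
      ContDiffAt ℝ ∞ (vectorComponents I X x) (extChartAt I x p) := by
  have hs : p ∈ (trivializationAt E (TangentSpace I) x).baseSet := by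
    rwa [extChartAt_source] at hp
  refine Iff.trans (Bundle.Trivialization.contMDiffAt_section_iff (IB := I) (n := ∞) (s := X)
    (trivializationAt E (TangentSpace I) x) hs) (contMDiffAt_iff_contDiffAt_of_comp hp ?_)
  intro q hq
  rw [vectorComponents_eq X ((extChartAt I x).map_source hq)]
  have := (extChartAt I x).left_inv hq
  exact (congrArg (fun r => tangentCoordChange I r x r (X r : E)) this).symm

theorem contMDiffAt_bilinField_iff {Ω : BilinField I M} {x p : M}
    (hp : p ∈ (extChartAt I x).source) :
    ContMDiffAt I (I.prod 𝓘(ℝ, E →L[ℝ] E →L[ℝ] ℝ)) ∞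
      (fun x : M => TotalSpace.mk' (E →L[ℝ] E →L[ℝ] ℝ)
        (E := fun x : M => (TangentSpace I x →L[ℝ] TangentSpace I x →L[ℝ] ℝ)) x (Ω x)) p ↔
      ContDiffAt ℝ ∞ (bilinComponents I Ω x) (extChartAt I x p) := by
  have hb : ∀ q ∈ (extChartAt I x).source,
      q ∈ (trivializationAt E (TangentSpace I) x).baseSet := by
    intro q hq
    rwa [extChartAt_source] at hq
  refine ((trivializationAt (E →L[ℝ] E →L[ℝ] ℝ)
    (fun x : M => (TangentSpace I x →L[ℝ] TangentSpace I x →L[ℝ] ℝ)) x).contMDiffAt_iff ?_).trans ?_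
  · exact ⟨hb p hp, hb p hp, Set.mem_univ _⟩
  refine Iff.trans (and_iff_right contMDiffAt_id) (contMDiffAt_iff_contDiffAt_of_comp hp ?_)
  intro q hq
  ext u v
  rw [bilinComponents_apply Ω ((extChartAt I x).map_source hq)]
  have h1 := (extChartAt I x).left_inv hq
  refine Eq.trans ?_ (congrArg (fun r => (Ω r : E →L[ℝ] E →L[ℝ] ℝ)
      (tangentCoordChange I x r r u) (tangentCoordChange I x r r v)) h1).symm
  -- The trivialization of the bundle of bilinear forms composes both arguments with the inverse
  -- trivialization of the tangent bundle, which is the frame of the chart at `x`.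
  have h2 := inCoordinates_apply_eq₂ (𝕜 := ℝ) (ϕ := Ω q) (v := u) (w := v)
    (F₃ := ℝ) (E₃ := Bundle.Trivial M ℝ) (hb q hq) (hb q hq) (by simp)
  refine Eq.trans h2 ?_
  rw [extChartAt_source] at hq
  have h3 : ∀ w : E, (trivializationAt E (TangentSpace I) x).symm q w =
      tangentCoordChange I x q q w := fun w =>
    (Bundle.Trivialization.symmL_apply (R := ℝ) (trivializationAt E (TangentSpace I) x) hq
      w).symm.trans
      (congrArg (fun T : E →L[ℝ] E => T w)
        (TangentBundle.symmL_trivializationAt_eq_core (I := I) hq))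
  rw [h3, h3]
  exact congrArg (fun T : ℝ →ₗ[ℝ] ℝ => T _) 
    (Bundle.Trivial.linearMapAt_trivialization ℝ M ℝ q)

theorem IsAlmostSymplectic.contDiffAt {Ω : BilinField I M} (hΩ : IsAlmostSymplectic I Ω) {x : M}
    {z : E} (hz : z ∈ (extChartAt I x).target) : ContDiffAt ℝ ∞ (bilinComponents I Ω x) z := by
  have h := (contMDiffAt_bilinField_iff ((extChartAt I x).map_target hz)).1 (hΩ.smooth _)
  rwa [(extChartAt I x).right_inv hz] at h

theorem SmoothVectorFieldOn.contDiffAt {X : (p : M) → TangentSpace I p} {U : Set M}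
    (hX : SmoothVectorFieldOn I X U) (hU : IsOpen U) {x : M} {z : E}
    (hz : z ∈ (extChartAt I x).target) (hzU : (extChartAt I x).symm z ∈ U) :
    ContDiffAt ℝ ∞ (vectorComponents I X x) z := by
  have h := (contMDiffAt_vectorField_iff ((extChartAt I x).map_target hz)).1
    ((hX _ hzU).contMDiffAt (hU.mem_nhds hzU))
  rwa [(extChartAt I x).right_inv hz] at h

/-! ### Change of charts -/

theorem bilinComponents_transition (Ω : BilinField I M) {x₀ x₁ : M} {z : E}
    (hz : z ∈ (extChartAt I x₀).target) (h₁ : (extChartAt I x₀).symm z ∈ (extChartAt I x₁).source) :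
    bilinComponents I Ω x₀ z =
      flatPullback (extChartAt I x₁ ∘ (extChartAt I x₀).symm) (bilinComponents I Ω x₁) z := by
  have h₀ := (extChartAt I x₀).map_target hz
  have hφ := fderiv_transition h₀ h₁
  rw [(extChartAt I x₀).right_inv hz] at hφ
  ext u v
  rw [bilinComponents_apply Ω hz, flatPullback, ContinuousLinearMap.bilinearComp_apply, hφ,
    Function.comp_apply, bilinComponents_apply Ω ((extChartAt I x₁).map_source h₁),
    (extChartAt I x₁).left_inv h₁]
  rw [tangentCoordChange_comp ⟨⟨h₀, h₁⟩, mem_extChartAt_source _⟩,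
    tangentCoordChange_comp ⟨⟨h₀, h₁⟩, mem_extChartAt_source _⟩]

theorem vectorComponents_transition (X : (p : M) → TangentSpace I p) {x₀ x₁ : M} {z : E}
    (hz : z ∈ (extChartAt I x₀).target) (h₁ : (extChartAt I x₀).symm z ∈ (extChartAt I x₁).source) :
    fderiv ℝ (extChartAt I x₁ ∘ (extChartAt I x₀).symm) z (vectorComponents I X x₀ z) =
      vectorComponents I X x₁ ((extChartAt I x₁ ∘ (extChartAt I x₀).symm) z) := by
  have h₀ := (extChartAt I x₀).map_target hz
  have hφ := fderiv_transition h₀ h₁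
  rw [(extChartAt I x₀).right_inv hz] at hφ
  rw [hφ, vectorComponents_eq X hz, Function.comp_apply,
    vectorComponents_eq X ((extChartAt I x₁).map_source h₁)]
  refine (tangentCoordChange_comp ⟨⟨mem_extChartAt_source _, h₀⟩, h₁⟩).trans ?_
  exact (congrArg (fun r => tangentCoordChange I r x₁ r (X r : E))
    ((extChartAt I x₁).left_inv h₁)).symm

theorem eventually_symm_mem {x₀ : M} {z : E} {U : Set M} (hU : IsOpen U)
    (hz : z ∈ (extChartAt I x₀).target) (hzU : (extChartAt I x₀).symm z ∈ U) :
    ∀ᶠ z' in 𝓝 z, z' ∈ (extChartAt I x₀).target ∧ (extChartAt I x₀).symm z' ∈ U := by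
  have hc : ContinuousAt (extChartAt I x₀).symm z := continuousAt_extChartAt_symm'' hz
  exact ((isOpen_extChartAt_target x₀).eventually_mem hz).and (hc.eventually (hU.mem_nhds hzU))

end Smoothness

/-! ### Lie brackets and Lie derivatives in charts -/

section Lie

variable {E : Type*} [NormedAddCommGroup E] [NormedSpace ℝ E]
  {H : Type*} [TopologicalSpace H] {I : ModelWithCorners ℝ E H} [I.Boundaryless]
  {M : Type*} [TopologicalSpace M] [ChartedSpace H M] [IsManifold I ∞ M]

theorem vectorComponents_self (X : (p : M) → TangentSpace I p) (x : M) :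
    vectorComponents I X x (extChartAt I x x) = (X x : E) := by
  rw [vectorComponents_eq X (mem_extChartAt_target x)]
  refine (congrArg (fun r => tangentCoordChange I r x r (X r : E))
    (extChartAt_to_inv (I := I) x)).trans ?_
  exact tangentCoordChange_self (mem_extChartAt_source x)

theorem bilinComponents_self (Ω : BilinField I M) (x : M) :
    bilinComponents I Ω x (extChartAt I x x) = (Ω x : E →L[ℝ] E →L[ℝ] ℝ) := by
  ext u v
  rw [bilinComponents_apply Ω (mem_extChartAt_target x), extChartAt_to_inv (I := I) x,
    tangentCoordChange_self (mem_extChartAt_source x),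
    tangentCoordChange_self (mem_extChartAt_source x)]
  rfl

theorem bilinComponents_vectorComponents (Ω : BilinField I M) (Y Z : (p : M) → TangentSpace I p)
    {x p : M} (hp : p ∈ (extChartAt I x).source) :
    Ω p (Y p) (Z p) = bilinComponents I Ω x (extChartAt I x p)
      (vectorComponents I Y x (extChartAt I x p)) (vectorComponents I Z x (extChartAt I x p)) := by
  have ht := (extChartAt I x).map_source hp
  have hc : ∀ q, q = p → (Ω q : E →L[ℝ] E →L[ℝ] ℝ)
      (tangentCoordChange I x q q (tangentCoordChange I q x q (Y q : E)))
      (tangentCoordChange I x q q (tangentCoordChange I q x q (Z q : E))) = Ω p (Y p) (Z p) := by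
    rintro q rfl
    exact congrArg₂ (fun a b : E => (Ω q : E →L[ℝ] E →L[ℝ] ℝ) a b)
      (tangentCoordChange_symm_apply hp _) (tangentCoordChange_symm_apply hp _)
  rw [bilinComponents_apply Ω ht, vectorComponents_eq Y ht, vectorComponents_eq Z ht]
  exact (hc _ ((extChartAt I x).left_inv hp)).symm

/-- Pulling back by the inverse chart applies the inverse of the frame, and that is the differential
of the chart. -/
theorem mpullbackWithin_extChartAt_symm (X : (p : M) → TangentSpace I p) {x : M} {z : E}
    (hz : z ∈ (extChartAt I x).target) :
    (mpullbackWithin 𝓘(ℝ, E) I (extChartAt I x).symm X (Set.range I) z : E) =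
      vectorComponents I X x z := by
  have hs := (extChartAt I x).map_target hz
  have hinv : ContinuousLinearMap.inverse (frame I x z : E →L[ℝ] E) =
      tangentCoordChange I ((extChartAt I x).symm z) x ((extChartAt I x).symm z) := by
    rw [frame_eq hz]
    refine ContinuousLinearMap.inverse_eq ?_ ?_
    · ext v; exact tangentCoordChange_symm_apply hs v
    · ext v; exact tangentCoordChange_apply_symm hs v
  rw [vectorComponents_eq X hz, ← hinv]
  rfl

/-- The Lie bracket of vector fields in the preferred chart at a point. -/
theorem mlieBracket_eq (X Y : (p : M) → TangentSpace I p) (x : M) :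
    (mlieBracket I X Y x : E) =
      fderiv ℝ (vectorComponents I Y x) (extChartAt I x x)
          (vectorComponents I X x (extChartAt I x x))
        - fderiv ℝ (vectorComponents I X x) (extChartAt I x x)
          (vectorComponents I Y x (extChartAt I x x)) := by
  have he : ∀ V : (p : M) → TangentSpace I p,
      (mpullbackWithin 𝓘(ℝ, E) I (extChartAt I x).symm V (Set.range I) : E → E)
        =ᶠ[𝓝 (extChartAt I x x)] vectorComponents I V x := fun V => by
    filter_upwards [(isOpen_extChartAt_target x).mem_nhds (mem_extChartAt_target x)] with z hz
    exact mpullbackWithin_extChartAt_symm V hz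
  have hb := Filter.EventuallyEq.lieBracket_vectorField_eq (𝕜 := ℝ) (he X) (he Y)
  rw [← mlieBracketWithin_univ, mlieBracketWithin_apply, mfderiv_extChartAt_self]
  refine (congrArg (fun T : E →L[ℝ] E => T _) ContinuousLinearMap.inverse_id).trans ?_
  have hu : (extChartAt I x).symm ⁻¹' Set.univ ∩ Set.range I = Set.univ := by
    rw [Set.preimage_univ, Set.univ_inter, I.range_eq_univ]
  rw [hu]
  have hw : ∀ V W : E → E, lieBracketWithin ℝ V W Set.univ (extChartAt I x x) =
      lieBracket ℝ V W (extChartAt I x x) := fun V W => by rw [lieBracketWithin_univ]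
  exact (hw _ _).trans hb

/-- In the product rule for `X(Ω(Y, Z))` the derivatives of `Y` and `Z` along `X` cancel against
those in the brackets. What remains depends only on the values of `Y` and `Z`. -/
theorem lieDerivative_eq {X Y Z : (p : M) → TangentSpace I p} {Ω : BilinField I M} {x : M}
    (hΩ : ContDiffAt ℝ ∞ (bilinComponents I Ω x) (extChartAt I x x))
    (hY : ContDiffAt ℝ ∞ (vectorComponents I Y x) (extChartAt I x x))
    (hZ : ContDiffAt ℝ ∞ (vectorComponents I Z x) (extChartAt I x x)) :
    lieDerivative I X Ω Y Z x =
      flatLie (bilinComponents I Ω x) (vectorComponents I X x) (extChartAt I x x)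
        (vectorComponents I Y x (extChartAt I x x)) (vectorComponents I Z x (extChartAt I x x)) := by
  have hh : ContMDiffAt I 𝓘(ℝ, ℝ) ∞ (fun p => Ω p (Y p) (Z p)) x :=
    (contMDiffAt_iff_contDiffAt_of_comp (mem_extChartAt_source x)
      (g := fun z => bilinComponents I Ω x z (vectorComponents I Y x z) (vectorComponents I Z x z))
      fun q hq => bilinComponents_vectorComponents Ω Y Z hq).2
      ((hΩ.clm_apply hY).clm_apply hZ)
  have hd := fderiv_functionExpression (hh.mdifferentiableAt (by simp)) (mem_extChartAt_source x)
    (vectorComponents I X x (extChartAt I x x))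
  rw [tangentCoordChange_self (mem_extChartAt_source x)] at hd
  have he : (fun p => Ω p (Y p) (Z p)) ∘ (extChartAt I x).symm =ᶠ[𝓝 (extChartAt I x x)]
      fun z => bilinComponents I Ω x z (vectorComponents I Y x z) (vectorComponents I Z x z) := by
    filter_upwards [(isOpen_extChartAt_target x).mem_nhds (mem_extChartAt_target x)] with z hz
    rw [Function.comp_apply,
      bilinComponents_vectorComponents Ω Y Z ((extChartAt I x).map_target hz),
      (extChartAt I x).right_inv hz]
  rw [he.fderiv_eq, fderiv_bilin_apply hΩ.hasFDerivAt_infty hY.hasFDerivAt_infty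
    hZ.hasFDerivAt_infty] at hd
  have key : ∀ (A : E →L[ℝ] E →L[ℝ] ℝ) (a b c d e : E), A = Ω x → a = X x → b = Y x →
      c = Z x → d = mlieBracket I X Y x → e = mlieBracket I X Z x → lieDerivative I X Ω Y Z x =
        (mvfderiv I (fun p : M => Ω p (Y p) (Z p)) x : E →L[ℝ] ℝ) a
          - A d c - A b e := by
    rintro _ _ _ _ _ _ rfl rfl rfl rfl rfl rfl
    rfl
  rw [key _ _ _ _ _ _ (bilinComponents_self Ω x) (vectorComponents_self X x)
    (vectorComponents_self Y x) (vectorComponents_self Z x) (mlieBracket_eq X Y x).symm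
    (mlieBracket_eq X Z x).symm, ← hd,
    flatLie]
  simp only [map_sub, sub_apply]
  ring

/-- Chart centres suffice, since every point is the centre of its own preferred chart. -/
theorem lieDerivativeEqZero_of_flatLie {X : (p : M) → TangentSpace I p} {Ω : BilinField I M}
    (hΩ : ∀ x, ContDiffAt ℝ ∞ (bilinComponents I Ω x) (extChartAt I x x))
    (h : ∀ x u v, flatLie (bilinComponents I Ω x) (vectorComponents I X x) (extChartAt I x x) u v
      = 0) : LieDerivativeEqZero I X Ω := by
  intro U hU Y Z hY hZ x hx
  have hx' : (extChartAt I x).symm (extChartAt I x x) ∈ U := by rwa [extChartAt_to_inv]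
  rw [lieDerivative_eq (hΩ x) (hY.contDiffAt hU (mem_extChartAt_target x) hx')
    (hZ.contDiffAt hU (mem_extChartAt_target x) hx')]
  exact h x _ _

/-- The vector field with constant components in the chart at `x`. -/
def coordinateField (I : ModelWithCorners ℝ E H) [IsManifold I ∞ M] (x : M) (u : E) (p : M) :
    TangentSpace I p :=
  tangentCoordChange I x p p u

theorem vectorComponents_coordinateField (x : M) (u : E) {z : E}
    (hz : z ∈ (extChartAt I x).target) :
    vectorComponents I (coordinateField I x u) x z = u := by
  rw [vectorComponents_eq _ hz]
  exact tangentCoordChange_apply_symm ((extChartAt I x).map_target hz) u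

theorem smoothVectorFieldOn_coordinateField (x : M) (u : E) :
    SmoothVectorFieldOn I (coordinateField I x u) (extChartAt I x).source := by
  intro p hp
  refine ((contMDiffAt_vectorField_iff hp).2 ?_).contMDiffWithinAt
  refine contDiffAt_const (c := u) |>.congr_of_eventuallyEq ?_
  filter_upwards [(isOpen_extChartAt_target x).mem_nhds ((extChartAt I x).map_source hp)] with z hz
  exact vectorComponents_coordinateField x u hz

/-- Vanishing is needed throughout the chart, not only at its centre, because the lift
differentiates it. At a centre, coordinate fields realize all `u`, `v`; any other point is moved to
the centre of its own chart by `flatLie_pullback`. -/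
theorem LieDerivativeEqZero.flatLie_eq_zero {X : (p : M) → TangentSpace I p} {Ω : BilinField I M}
    (hΩ : IsAlmostSymplectic I Ω) (hX : SmoothVectorFieldOn I X Set.univ)
    (h : LieDerivativeEqZero I X Ω) {x : M} {z : E} (hz : z ∈ (extChartAt I x).target) (u v : E) :
    flatLie (bilinComponents I Ω x) (vectorComponents I X x) z u v = 0 := by
  have hcenter : ∀ (x : M) (u v : E), flatLie (bilinComponents I Ω x) (vectorComponents I X x)
      (extChartAt I x x) u v = 0 := by
    intro x u v
    have hx := mem_extChartAt_target (I := I) x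
    have hs : (extChartAt I x).symm (extChartAt I x x) ∈ (extChartAt I x).source :=
      (extChartAt I x).map_target hx
    -- Coordinate fields are smooth only on the chart domain, hence the use of locally defined
    -- fields.
    have h0 := h _ (isOpen_extChartAt_source x) _ _ (smoothVectorFieldOn_coordinateField x u)
      (smoothVectorFieldOn_coordinateField x v) x (mem_extChartAt_source x)
    rwa [lieDerivative_eq (hΩ.contDiffAt hx)
      ((smoothVectorFieldOn_coordinateField x u).contDiffAt (isOpen_extChartAt_source x) hx hs)
      ((smoothVectorFieldOn_coordinateField x v).contDiffAt (isOpen_extChartAt_source x) hx hs),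
      vectorComponents_coordinateField x u hx, vectorComponents_coordinateField x v hx] at h0
  have h₀ := (extChartAt I x).map_target hz
  set x₁ := (extChartAt I x).symm z with hx₁
  have h₁ : x₁ ∈ (extChartAt I x₁).source := mem_extChartAt_source x₁
  have hφ := contDiffAt_transition h₀ h₁
  rw [(extChartAt I x).right_inv hz] at hφ
  have ht := (extChartAt I x₁).map_source h₁
  have hev := eventually_symm_mem (isOpen_extChartAt_source (I := I) x₁) hz h₁
  rw [flatLie_pullback hφ (hΩ.contDiffAt ht) ((hΩ.contDiffAt hz).differentiableAt (by simp))
    (hX.contDiffAt isOpen_univ hz trivial) (hX.contDiffAt isOpen_univ ht trivial)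
    (hev.mono fun z' hz' => bilinComponents_transition Ω hz'.1 hz'.2)
    (hev.mono fun z' hz' => vectorComponents_transition X hz'.1 hz'.2)]
  exact hcenter x₁ _ _

end Lie

/-! ### Naturality of the complete lift of vector fields -/

section FlatRelated

variable {E : Type*} [NormedAddCommGroup E] [NormedSpace ℝ E]
  {F : Type*} [NormedAddCommGroup F] [NormedSpace ℝ F]

/-- The complete lifts of `φ`-related vector fields are related by the tangent map of `φ`. -/
theorem fderiv_flatTangent_related {φ : E → F} {ξ : E → E} {η : F → F} {p : E × E}
    (hφ : ContDiffAt ℝ ∞ φ p.1) (hξ : ContDiffAt ℝ ∞ ξ p.1) (hη : ContDiffAt ℝ ∞ η (φ p.1))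
    (h : ∀ᶠ z in 𝓝 p.1, fderiv ℝ φ z (ξ z) = η (φ z)) :
    fderiv ℝ (flatTangent φ) p (flatTangent ξ p) = flatTangent η (flatTangent φ p) := by
  have e1 : fderiv ℝ (fun z => fderiv ℝ φ z (ξ z)) p.1 = fderiv ℝ (fun z => η (φ z)) p.1 :=
    Filter.EventuallyEq.fderiv_eq h
  rw [(hφ.fderiv_infty.hasFDerivAt_infty.clm_apply hξ.hasFDerivAt_infty).fderiv,
    (show HasFDerivAt (fun z => η (φ z)) _ p.1 from
      hη.hasFDerivAt_infty.comp p.1 hφ.hasFDerivAt_infty).fderiv] at e1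
  have e2 := congrArg (fun T => T p.2) e1
  simp only [add_apply, ContinuousLinearMap.comp_apply, ContinuousLinearMap.flip_apply] at e2
  rw [fderiv_flatTangent hφ]
  refine Prod.ext h.self_of_nhds ?_
  simp only [flatTangent]
  rw [← e2, hφ.fderiv_fderiv_comm]

end FlatRelated

/-! ### Lifts in natural charts, and the first two assertions -/

section Lifts

variable {E : Type*} [NormedAddCommGroup E] [NormedSpace ℝ E]
  {H : Type*} [TopologicalSpace H] {I : ModelWithCorners ℝ E H} [I.Boundaryless]
  {M : Type*} [TopologicalSpace M] [ChartedSpace H M] [IsManifold I ∞ M]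
  {F : Type*} [NormedAddCommGroup F] [NormedSpace ℝ F]

/-- Only the value at `y` in the chart centred at `y.proj` is involved; the absence of boundary
turns derivatives within `Set.range I` into ordinary ones. -/
theorem bilinLift_eq (σ : BilinField I M) (y : TangentBundle I M) :
    (bilinLift I σ y : E × E →L[ℝ] E × E →L[ℝ] ℝ) =
      flatLift (bilinComponents I σ y.proj) (extChartAt I.tangent y y) := by
  rw [extChartAt_tangent_self]
  unfold bilinLift flatLift
  rw [I.range_eq_univ, fderivWithin_univ]

theorem vectorLift_eq (X : (p : M) → TangentSpace I p) (y : TangentBundle I M) :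
    (vectorLift I X y : E × E) =
      flatTangent (vectorComponents I X y.proj) (extChartAt I.tangent y y) := by
  rw [extChartAt_tangent_self]
  unfold vectorLift flatTangent
  rw [I.range_eq_univ, fderivWithin_univ]

/-- In natural charts of the tangent bundle, the change of charts is the tangent map of the change
of charts of the base. -/
theorem extChartAt_tangent_transition {y₀ y₁ : TangentBundle I M} {p : E × E}
    (hp : p.1 ∈ (extChartAt I y₀.proj).target)
    (h₁ : (extChartAt I y₀.proj).symm p.1 ∈ (extChartAt I y₁.proj).source) :
    (extChartAt I.tangent y₁ ∘ (extChartAt I.tangent y₀).symm) p =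
      flatTangent (extChartAt I y₁.proj ∘ (extChartAt I y₀.proj).symm) p := by
  have h₀ := (extChartAt I y₀.proj).map_target hp
  have hφ := fderiv_transition h₀ h₁
  rw [(extChartAt I y₀.proj).right_inv hp] at hφ
  have hq := extChartAt_tangent_symm (y := y₀) p.2 hp
  rw [Function.comp_apply, flatTangent, hφ]
  refine (congrArg (extChartAt I.tangent y₁) hq).trans ?_
  exact Prod.ext rfl (tangentCoordChange_comp ⟨⟨h₀, mem_extChartAt_source _⟩, h₁⟩)

theorem proj_extChartAt_tangent_symm {y : TangentBundle I M} {p : E × E}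
    (hp : p.1 ∈ (extChartAt I y.proj).target) :
    ((extChartAt I.tangent y).symm p).proj = (extChartAt I y.proj).symm p.1 := by
  rw [show p = (p.1, p.2) from rfl, extChartAt_tangent_symm p.2 hp]

theorem tangentCoordChange_tangent {y q : TangentBundle I M} {p : E × E}
    (hp : p.1 ∈ (extChartAt I y.proj).target) (hq : (extChartAt I.tangent y).symm p = q) :
    tangentCoordChange I.tangent y q q =
      fderiv ℝ (flatTangent (extChartAt I q.proj ∘ (extChartAt I y.proj).symm)) p := by
  have hp' : p ∈ (extChartAt I.tangent y).target := mem_extChartAt_tangent_target.2 hp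
  have hqs : q ∈ (extChartAt I.tangent y).source := by
    rw [← hq]; exact (extChartAt I.tangent y).map_target hp'
  have hpq : extChartAt I.tangent y q = p := by
    rw [← hq]; exact (extChartAt I.tangent y).right_inv hp'
  have hproj : (extChartAt I y.proj).symm p.1 = q.proj := by
    rw [← proj_extChartAt_tangent_symm hp, hq]
  rw [← fderiv_transition hqs (mem_extChartAt_source q), hpq]
  refine Filter.EventuallyEq.fderiv_eq ?_
  have h₁ : (extChartAt I y.proj).symm p.1 ∈ (extChartAt I q.proj).source := by
    rw [hproj]; exact mem_extChartAt_source _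
  filter_upwards [continuousAt_fst.eventually
    (eventually_symm_mem (isOpen_extChartAt_source (I := I) q.proj) hp h₁)] with p' hp'
  exact extChartAt_tangent_transition hp'.1 hp'.2

/-- The coordinate expression of the complete lift of a field of bilinear forms. -/
theorem bilinComponents_bilinLift {σ : BilinField I M} {y : TangentBundle I M}
    (hσ : ∀ (x : M) (z : E), z ∈ (extChartAt I x).target →
      ContDiffAt ℝ ∞ (bilinComponents I σ x) z) {p : E × E}
    (hp : p.1 ∈ (extChartAt I y.proj).target) :
    bilinComponents I.tangent (bilinLift I σ) y p = flatLift (bilinComponents I σ y.proj) p := by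
  -- The lift at `q` is defined through the chart at `q.proj`, whereas the components are taken in
  -- the chart of `y`. Passing between them is the chart independence of `σ^c`, supplied by
  -- `flatLift_pullback` for the transition map.
  obtain ⟨q, hq⟩ : ∃ q, (extChartAt I.tangent y).symm p = q := ⟨_, rfl⟩
  have hproj : (extChartAt I y.proj).symm p.1 = q.proj := by
    rw [← proj_extChartAt_tangent_symm hp, hq]
  have h₀ := (extChartAt I y.proj).map_target hp
  have h₁ : (extChartAt I y.proj).symm p.1 ∈ (extChartAt I q.proj).source := by
    rw [hproj]; exact mem_extChartAt_source _
  have hφ := contDiffAt_transition h₀ h₁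
  rw [(extChartAt I y.proj).right_inv hp] at hφ
  have hχ : extChartAt I.tangent q q =
      flatTangent (extChartAt I q.proj ∘ (extChartAt I y.proj).symm) p := by
    rw [← extChartAt_tangent_transition hp h₁, Function.comp_apply, hq]
  refine ContinuousLinearMap.ext fun U => ContinuousLinearMap.ext fun V => ?_
  rw [bilinComponents_apply _ (mem_extChartAt_tangent_target.2 hp), hq, bilinLift_eq,
    tangentCoordChange_tangent hp hq, hχ]
  exact (flatLift_pullback hφ (hσ _ _ ((extChartAt I q.proj).map_source h₁))
    ((hσ _ _ hp).differentiableAt (by simp))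
    ((eventually_symm_mem (isOpen_extChartAt_source (I := I) q.proj) hp h₁).mono fun z' hz' =>
      bilinComponents_transition σ hz'.1 hz'.2) U V).symm

/-- The coordinate expression of the complete lift of a vector field. -/
theorem vectorComponents_vectorLift {X : (p : M) → TangentSpace I p} {y : TangentBundle I M}
    (hX : SmoothVectorFieldOn I X Set.univ) {p : E × E}
    (hp : p.1 ∈ (extChartAt I y.proj).target) :
    vectorComponents I.tangent (vectorLift I X) y p =
      flatTangent (vectorComponents I X y.proj) p := by
  obtain ⟨q, hq⟩ : ∃ q, (extChartAt I.tangent y).symm p = q := ⟨_, rfl⟩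
  have hproj : (extChartAt I y.proj).symm p.1 = q.proj := by
    rw [← proj_extChartAt_tangent_symm hp, hq]
  have h₀ := (extChartAt I y.proj).map_target hp
  have h₁ : (extChartAt I y.proj).symm p.1 ∈ (extChartAt I q.proj).source := by
    rw [hproj]; exact mem_extChartAt_source _
  have hφ := contDiffAt_transition h₀ h₁
  rw [(extChartAt I y.proj).right_inv hp] at hφ
  have hχ : extChartAt I.tangent q q =
      flatTangent (extChartAt I q.proj ∘ (extChartAt I y.proj).symm) p := by
    rw [← extChartAt_tangent_transition hp h₁, Function.comp_apply, hq]
  have hp' : p ∈ (extChartAt I.tangent y).target := mem_extChartAt_tangent_target.2 hp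
  have hqs : q ∈ (extChartAt I.tangent y).source := by
    rw [← hq]; exact (extChartAt I.tangent y).map_target hp'
  rw [vectorComponents_eq _ hp', hq, vectorLift_eq, hχ,
    ← fderiv_flatTangent_related hφ (hX.contDiffAt isOpen_univ hp trivial)
      (hX.contDiffAt isOpen_univ ((extChartAt I q.proj).map_source h₁) trivial)
      ((eventually_symm_mem (isOpen_extChartAt_source (I := I) q.proj) hp h₁).mono fun z' hz' =>
        vectorComponents_transition X hz'.1 hz'.2),
    ← tangentCoordChange_tangent hp hq]
  exact tangentCoordChange_apply_symm hqs _

/-- The coordinate expression of the complete lift of a function. -/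
theorem functionLift_extChartAt_symm {f : M → F} (hf : ContMDiff I 𝓘(ℝ, F) ∞ f)
    {y : TangentBundle I M} {p : E × E} (hp : p.1 ∈ (extChartAt I y.proj).target) :
    functionLift I f ((extChartAt I.tangent y).symm p) =
      fderiv ℝ (f ∘ (extChartAt I y.proj).symm) p.1 p.2 := by
  have h := fderiv_functionExpression ((hf _).mdifferentiableAt (by simp))
    ((extChartAt I y.proj).map_target hp) p.2
  rw [(extChartAt I y.proj).right_inv hp] at h
  rw [h]
  exact congrArg (functionLift I f) (extChartAt_tangent_symm p.2 hp)

/-- `f^c` is the fibre component of the tangent map of `f`. -/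
theorem contMDiff_functionLift {f : M → F} (hf : ContMDiff I 𝓘(ℝ, F) ∞ f) :
    ContMDiff I.tangent 𝓘(ℝ, F) ∞ (functionLift I f) :=
  (contMDiff_snd_tangentBundle_modelSpace F 𝓘(ℝ, F)).comp
    (hf.contMDiff_tangentMap (m := ∞) (by simp))

theorem smoothVectorFieldOn_vectorLift {X : (p : M) → TangentSpace I p}
    (hX : SmoothVectorFieldOn I X Set.univ) :
    SmoothVectorFieldOn I.tangent (vectorLift I X) Set.univ := by
  intro y _
  refine ((contMDiffAt_vectorField_iff (mem_extChartAt_source y)).2 ?_).contMDiffWithinAt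
  have hy : (extChartAt I.tangent y y).1 ∈ (extChartAt I y.proj).target :=
    mem_extChartAt_target y.proj
  refine (contDiffAt_flatTangent (hX.contDiffAt isOpen_univ hy trivial)).congr_of_eventuallyEq ?_
  filter_upwards [continuousAt_fst.eventually ((isOpen_extChartAt_target y.proj).mem_nhds hy)]
    with p hp
  exact vectorComponents_vectorLift hX hp

theorem IsAlmostSymplectic.bilinLift {σ : BilinField I M} (hσ : IsAlmostSymplectic I σ) :
    IsAlmostSymplectic I.tangent (bilinLift I σ) := by
  have hσ' : ∀ (x : M) (z : E), z ∈ (extChartAt I x).target →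
      ContDiffAt ℝ ∞ (bilinComponents I σ x) z := fun x z hz => hσ.contDiffAt hz
  have hy : ∀ y : TangentBundle I M,
      (extChartAt I.tangent y y).1 ∈ (extChartAt I y.proj).target := fun y =>
    mem_extChartAt_target y.proj
  refine ⟨fun y => ?_, fun y => ?_, fun y => ?_⟩
  · refine (contMDiffAt_bilinField_iff (mem_extChartAt_source y)).2 ?_
    refine (contDiffAt_flatLift (hσ' _ _ (hy y))).congr_of_eventuallyEq ?_
    filter_upwards [continuousAt_fst.eventually
      ((isOpen_extChartAt_target y.proj).mem_nhds (hy y))] with p hp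
    exact bilinComponents_bilinLift hσ' hp
  · have hs : ∀ z ∈ (extChartAt I y.proj).target, ∀ u v : E,
        bilinComponents I σ y.proj z u v = - bilinComponents I σ y.proj z v u := by
      intro z hz u v
      rw [bilinComponents_apply σ hz, bilinComponents_apply σ hz]
      exact hσ.skew _ _ _
    have h := flatLift_skew (hσ' _ _ (hy y))
      (Filter.eventually_of_mem ((isOpen_extChartAt_target y.proj).mem_nhds (hy y)) hs)
    rw [← bilinLift_eq] at h
    exact h
  · have h := flatLift_nondegenerate (s := bilinComponents I σ y.proj)
      (p := extChartAt I.tangent y y) (fun u hu => by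
        have e : (extChartAt I.tangent y y).1 = extChartAt I y.proj y.proj := rfl
        rw [e, bilinComponents_self] at hu
        exact hσ.nondegenerate _ u hu)
    rw [← bilinLift_eq] at h
    exact h

theorem IsHamiltonian.lift {σ : BilinField I M} (hσ : IsAlmostSymplectic I σ)
    {X : (p : M) → TangentSpace I p} {f : M → ℝ} (h : IsHamiltonian I σ X f) :
    IsHamiltonian I.tangent (AlmostSymplectic.bilinLift I σ) (vectorLift I X)
      (functionLift I f) := by
  have hσ' : ∀ (x : M) (z : E), z ∈ (extChartAt I x).target →
      ContDiffAt ℝ ∞ (bilinComponents I σ x) z := fun x z hz => hσ.contDiffAt hz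
  have hX := h.smooth_field
  have hy : ∀ y : TangentBundle I M,
      (extChartAt I.tangent y y).1 ∈ (extChartAt I y.proj).target := fun y =>
    mem_extChartAt_target y.proj
  have hnear : ∀ y : TangentBundle I M, ∀ᶠ p in 𝓝 (extChartAt I.tangent y y),
      p.1 ∈ (extChartAt I y.proj).target := fun y =>
    continuousAt_fst.eventually ((isOpen_extChartAt_target y.proj).mem_nhds (hy y))
  refine ⟨smoothVectorFieldOn_vectorLift hX, contMDiff_functionLift h.smooth_function, ?_, ?_⟩
  · refine lieDerivativeEqZero_of_flatLie (fun y => hσ.bilinLift.contDiffAt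
      (mem_extChartAt_target y)) fun y U V => ?_
    have e1 : bilinComponents I.tangent (AlmostSymplectic.bilinLift I σ) y
        =ᶠ[𝓝 (extChartAt I.tangent y y)] flatLift (bilinComponents I σ y.proj) :=
      (hnear y).mono fun p hp => bilinComponents_bilinLift hσ' hp
    have e2 : vectorComponents I.tangent (vectorLift I X) y
        =ᶠ[𝓝 (extChartAt I.tangent y y)] flatTangent (vectorComponents I X y.proj) :=
      (hnear y).mono fun p hp => vectorComponents_vectorLift hX hp
    have h0 := flatLie_lift_eq_zero (hσ' _ _ (hy y)) (hX.contDiffAt isOpen_univ (hy y) trivial)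
      (Filter.eventually_of_mem ((isOpen_extChartAt_target y.proj).mem_nhds (hy y)) fun z hz =>
        h.lie_eq_zero.flatLie_eq_zero hσ hX hz) U V
    rw [← h0, flatLie, flatLie, e1.fderiv_eq, e2.fderiv_eq, e1.self_of_nhds, e2.self_of_nhds]
  · intro y
    suffices hs : ∀ V : E × E, (AlmostSymplectic.bilinLift I σ y : E × E →L[ℝ] E × E →L[ℝ] ℝ)
        (vectorLift I X y : E × E) V
          = - (mvfderiv I.tangent (functionLift I f) y : E × E →L[ℝ] ℝ) V from hs
    intro V
    have hf' : ContDiffAt ℝ ∞ (f ∘ (extChartAt I y.proj).symm) (extChartAt I.tangent y y).1 :=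
      contDiffAt_functionExpression (h.smooth_function y.proj) (mem_extChartAt_source y.proj)
    have hc : ∀ z ∈ (extChartAt I y.proj).target, ∀ v : E, bilinComponents I σ y.proj z
        (vectorComponents I X y.proj z) v = - fderiv ℝ (f ∘ (extChartAt I y.proj).symm) z v := by
      intro z hz v
      have hs := (extChartAt I y.proj).map_target hz
      have hd := fderiv_functionExpression ((h.smooth_function _).mdifferentiableAt (by simp)) hs v
      rw [(extChartAt I y.proj).right_inv hz] at hd
      rw [bilinComponents_apply σ hz, vectorComponents_eq X hz, hd]
      have e := tangentCoordChange_symm_apply hs (X ((extChartAt I y.proj).symm z) : E)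
      refine (congrArg (fun a : E => (σ ((extChartAt I y.proj).symm z) : E →L[ℝ] E →L[ℝ] ℝ) a
        _) e).trans ?_
      exact h.contraction _ _
    have h1 := flatLift_contraction (hσ' _ _ (hy y)) (hX.contDiffAt isOpen_univ (hy y) trivial) hf'
      (Filter.eventually_of_mem ((isOpen_extChartAt_target y.proj).mem_nhds (hy y)) hc) V
    have e3 : functionLift I f ∘ (extChartAt I.tangent y).symm
        =ᶠ[𝓝 (extChartAt I.tangent y y)]
        fun q : E × E => fderiv ℝ (f ∘ (extChartAt I y.proj).symm) q.1 q.2 :=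
      (hnear y).mono fun p hp => functionLift_extChartAt_symm h.smooth_function hp
    have h2 := fderiv_functionExpression
      (((contMDiff_functionLift h.smooth_function) y).mdifferentiableAt (by simp))
      (mem_extChartAt_source y) V
    rw [e3.fderiv_eq] at h2
    rw [tangentCoordChange_self (mem_extChartAt_source y)] at h2
    rw [h2, ← bilinLift_eq, ← vectorLift_eq] at h1
    exact h1

end Lifts

/-! ### Families of maps: commuting parameter and space derivatives -/

section FlatFamily

variable {P : Type*} [NormedAddCommGroup P] [NormedSpace ℝ P]
  {E : Type*} [NormedAddCommGroup E] [NormedSpace ℝ E]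
  {F : Type*} [NormedAddCommGroup F] [NormedSpace ℝ F]

/-- The derivative with respect to the parameters of the tangent maps of a family of maps is the
complete lift of the derivative of the family. -/
theorem fderiv_flatTangent_family {A : P × E → F} {a : P} {p : E × E}
    (hA : ContDiffAt ℝ ∞ A (a, p.1)) (ξ : P) :
    fderiv ℝ (fun b => flatTangent (fun z => A (b, z)) p) a ξ =
      flatTangent (fun z => fderiv ℝ (fun b => A (b, z)) a ξ) p := by
  have hev : ∀ᶠ q in 𝓝 (a, p.1), DifferentiableAt ℝ A q := by
    have h1 : ContDiffAt ℝ 1 A (a, p.1) := hA.of_le (by simp)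
    exact (h1.eventually (by simp)).mono fun q hq => hq.differentiableAt (by simp)
  have hi1 : ∀ (b : P) (z : E), HasFDerivAt (fun b' : P => (b', z))
      (ContinuousLinearMap.inl ℝ P E) b := fun b z =>
    (hasFDerivAt_id b).prodMk (hasFDerivAt_const z b)
  have hi2 : ∀ (b : P) (z : E), HasFDerivAt (fun z' : E => (b, z'))
      (ContinuousLinearMap.inr ℝ P E) z := fun b z =>
    (hasFDerivAt_const b z).prodMk (hasFDerivAt_id z)
  have hD := hA.fderiv_infty.hasFDerivAt_infty
  have k1 : HasFDerivAt (fun b => A (b, p.1)) _ a :=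
    hA.hasFDerivAt_infty.comp a (hi1 a p.1)
  have k2 : HasFDerivAt (fun b => fderiv ℝ A (b, p.1)) _ a := hD.comp a (hi1 a p.1)
  have k3 : HasFDerivAt (fun z => fderiv ℝ A (a, z)) _ p.1 := hD.comp p.1 (hi2 a p.1)
  have k4 := k2.clm_apply (hasFDerivAt_const ((0 : P), p.2) a)
  have k5 := k3.clm_apply (hasFDerivAt_const (ξ, (0 : E)) p.1)
  have e1 : (fun b => flatTangent (fun z => A (b, z)) p) =ᶠ[𝓝 a]
      fun b => (A (b, p.1), fderiv ℝ A (b, p.1) (0, p.2)) := by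
    filter_upwards [(hi1 a p.1).continuousAt.eventually hev] with b hb
    have h : HasFDerivAt (fun z => A (b, z)) _ p.1 := hb.hasFDerivAt.comp p.1 (hi2 b p.1)
    rw [flatTangent, h.fderiv]
    rfl
  have e2 : (fun z => fderiv ℝ (fun b => A (b, z)) a ξ) =ᶠ[𝓝 p.1]
      fun z => fderiv ℝ A (a, z) (ξ, 0) := by
    filter_upwards [(hi2 a p.1).continuousAt.eventually hev] with z hz
    have h : HasFDerivAt (fun b => A (b, z)) _ a := hz.hasFDerivAt.comp a (hi1 a z)
    rw [h.fderiv]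
    rfl
  rw [e1.fderiv_eq, (k1.prodMk k4).fderiv, flatTangent, e2.fderiv_eq, k5.fderiv]
  rw [show fderiv ℝ (fun b => A (b, p.1)) a ξ = fderiv ℝ A (a, p.1) (ξ, 0) from e2.self_of_nhds]
  refine Prod.ext rfl ?_
  -- The fibre components are the two mixed second derivatives of `A`, in the parameter direction
  -- `ξ` and the space direction `p.2`.
  have hc := hA.fderiv_fderiv_comm (ξ, (0 : E)) ((0 : P), p.2)
  simpa using hc

end FlatFamily

/-! ### Tangent maps and complete lifts -/

section TangentMap

variable {E : Type*} [NormedAddCommGroup E] [NormedSpace ℝ E]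
  {H : Type*} [TopologicalSpace H] {I : ModelWithCorners ℝ E H} [I.Boundaryless]
  {M : Type*} [TopologicalSpace M] [ChartedSpace H M] [IsManifold I ∞ M]
  {E' : Type*} [NormedAddCommGroup E'] [NormedSpace ℝ E']
  {H' : Type*} [TopologicalSpace H'] {I' : ModelWithCorners ℝ E' H'} [I'.Boundaryless]
  {M' : Type*} [TopologicalSpace M'] [ChartedSpace H' M'] [IsManifold I' ∞ M']
  {F : Type*} [NormedAddCommGroup F] [NormedSpace ℝ F]
  {F' : Type*} [NormedAddCommGroup F'] [NormedSpace ℝ F']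

/-- In natural charts, the tangent map is the tangent map of the coordinate expression. -/
theorem extChartAt_tangentMap {f : M → M'} {y₀ y : TangentBundle I M} {y₁ : TangentBundle I' M'}
    (hf : MDifferentiableAt I I' f y.proj) (h₀ : y.proj ∈ (extChartAt I y₀.proj).source)
    (h₁ : f y.proj ∈ (extChartAt I' y₁.proj).source) :
    extChartAt I'.tangent y₁ (tangentMap I I' f y) =
      flatTangent (extChartAt I' y₁.proj ∘ f ∘ (extChartAt I y₀.proj).symm)
        (extChartAt I.tangent y₀ y) := by
  have h := fderiv_chartExpression hf h₀ h₁ (extChartAt I.tangent y₀ y).2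
  refine Prod.ext ?_ ?_
  · exact congrArg (fun q => extChartAt I' y₁.proj (f q)) ((extChartAt I y₀.proj).left_inv h₀).symm
  · refine Eq.trans ?_ h.symm
    exact congrArg (fun v : E => tangentCoordChange I' (f y.proj) y₁.proj (f y.proj)
      ((mfderiv I I' f y.proj : E →L[ℝ] E') v)) (tangentCoordChange_symm_apply h₀ (y.2 : E)).symm

/-- The differential of a tangent map, in the natural charts at a point and at its image. -/
theorem mfderiv_tangentMap_apply {f : M → M'} (hf : ContMDiff I I' ∞ f) (y : TangentBundle I M)
    (U : E × E) :
    (mfderiv I.tangent I'.tangent (tangentMap I I' f) y : E × E →L[ℝ] E' × E') U =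
      fderiv ℝ (flatTangent (extChartAt I' (f y.proj) ∘ f ∘ (extChartAt I y.proj).symm))
        (extChartAt I.tangent y y) U := by
  have hT : ContMDiff I.tangent I'.tangent ∞ (tangentMap I I' f) :=
    hf.contMDiff_tangentMap (m := ∞) (by simp)
  have h := fderiv_chartExpression (x₁ := tangentMap I I' f y) ((hT y).mdifferentiableAt (by simp))
    (mem_extChartAt_source y) (mem_extChartAt_source _) U
  rw [tangentCoordChange_self (mem_extChartAt_source _)] at h
  refine (h.trans (tangentCoordChange_self (mem_extChartAt_source _))).symm.trans ?_
  refine congrArg (fun T : E × E →L[ℝ] E' × E' => T U) (Filter.EventuallyEq.fderiv_eq ?_)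
  have hy : (extChartAt I.tangent y y).1 ∈ (extChartAt I y.proj).target :=
    mem_extChartAt_target y.proj
  have hU : IsOpen (f ⁻¹' (extChartAt I' (f y.proj)).source) :=
    (isOpen_extChartAt_source _).preimage hf.continuous
  have hyU : (extChartAt I y.proj).symm (extChartAt I.tangent y y).1 ∈
      f ⁻¹' (extChartAt I' (f y.proj)).source := by
    have e : (extChartAt I y.proj).symm (extChartAt I.tangent y y).1 = y.proj :=
      extChartAt_to_inv (I := I) y.proj
    rw [e]
    exact mem_extChartAt_source _
  filter_upwards [continuousAt_fst.eventually (eventually_symm_mem hU hy hyU)] with p hp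
  have hp' : p ∈ (extChartAt I.tangent y).target := mem_extChartAt_tangent_target.2 hp.1
  have hproj := proj_extChartAt_tangent_symm hp.1
  have h2 := extChartAt_tangentMap (y₀ := y) (y := (extChartAt I.tangent y).symm p)
    (y₁ := tangentMap I I' f y) ((hf _).mdifferentiableAt (by simp))
    (by rw [hproj]; exact (extChartAt I y.proj).map_target hp.1) (by rw [hproj]; exact hp.2)
  rw [(extChartAt I.tangent y).right_inv hp'] at h2
  exact h2

/-- The tangent map of a map that preserves a field of bilinear forms preserves its complete
lift. -/
theorem bilinLift_tangentMap {σ : BilinField I M} {f : M → M} (hσ : IsAlmostSymplectic I σ)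
    (hf : ContMDiff I I ∞ f)
    (h : ∀ (x : M) (u v : TangentSpace I x),
      σ (f x) (mfderiv I I f x u) (mfderiv I I f x v) = σ x u v)
    (y : TangentBundle I M) (U V : TangentSpace I.tangent y) :
    bilinLift I σ (tangentMap I I f y) (mfderiv I.tangent I.tangent (tangentMap I I f) y U)
      (mfderiv I.tangent I.tangent (tangentMap I I f) y V) = bilinLift I σ y U V := by
  suffices hs : ∀ U V : E × E,
      (bilinLift I σ (tangentMap I I f y) : E × E →L[ℝ] E × E →L[ℝ] ℝ)
        ((mfderiv I.tangent I.tangent (tangentMap I I f) y : E × E →L[ℝ] E × E) U)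
        ((mfderiv I.tangent I.tangent (tangentMap I I f) y : E × E →L[ℝ] E × E) V) =
      (bilinLift I σ y : E × E →L[ℝ] E × E →L[ℝ] ℝ) U V from hs U V
  intro U V
  have hy : (extChartAt I.tangent y y).1 ∈ (extChartAt I y.proj).target :=
    mem_extChartAt_target y.proj
  have e : (extChartAt I y.proj).symm (extChartAt I.tangent y y).1 = y.proj :=
    extChartAt_to_inv (I := I) y.proj
  have hU : IsOpen (f ⁻¹' (extChartAt I (f y.proj)).source) :=
    (isOpen_extChartAt_source _).preimage hf.continuous
  have hyU : (extChartAt I y.proj).symm (extChartAt I.tangent y y).1 ∈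
      f ⁻¹' (extChartAt I (f y.proj)).source := by
    rw [e]
    exact mem_extChartAt_source _
  have hφ : ContDiffAt ℝ ∞ (extChartAt I (f y.proj) ∘ f ∘ (extChartAt I y.proj).symm)
      (extChartAt I.tangent y y).1 :=
    contDiffAt_chartExpression (hf y.proj) (mem_extChartAt_source _) (mem_extChartAt_source _)
  -- In the charts at `y.proj` and `f y.proj`, the invariance of `σ` says that its components are
  -- pulled back to each other by the expression of `f`. This is the hypothesis of
  -- `flatLift_pullback`.
  have hpull : ∀ z, (z ∈ (extChartAt I y.proj).target ∧
      (extChartAt I y.proj).symm z ∈ f ⁻¹' (extChartAt I (f y.proj)).source) →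
      bilinComponents I σ y.proj z =
        flatPullback (extChartAt I (f y.proj) ∘ f ∘ (extChartAt I y.proj).symm)
          (bilinComponents I σ (f y.proj)) z := by
    rintro z ⟨hz, hzf⟩
    have hs := (extChartAt I y.proj).map_target hz
    have hd := fderiv_chartExpression ((hf _).mdifferentiableAt (by simp)) hs hzf
    rw [(extChartAt I y.proj).right_inv hz] at hd
    obtain ⟨D, hD, hd⟩ : ∃ D : E →L[ℝ] E, D = mfderiv I I f ((extChartAt I y.proj).symm z) ∧
        ∀ u, fderiv ℝ (extChartAt I (f y.proj) ∘ f ∘ (extChartAt I y.proj).symm) z u =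
          tangentCoordChange I (f ((extChartAt I y.proj).symm z)) (f y.proj)
            (f ((extChartAt I y.proj).symm z)) (D (tangentCoordChange I y.proj
              ((extChartAt I y.proj).symm z) ((extChartAt I y.proj).symm z) u)) := ⟨_, rfl, hd⟩
    ext u v
    rw [flatPullback, ContinuousLinearMap.bilinearComp_apply, hd, hd, Function.comp_apply,
      Function.comp_apply, bilinComponents_apply σ ((extChartAt I (f y.proj)).map_source hzf),
      (extChartAt I (f y.proj)).left_inv hzf, tangentCoordChange_symm_apply hzf,
      tangentCoordChange_symm_apply hzf, bilinComponents_apply σ hz]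
    subst hD
    exact (h _ _ _).symm
  have ht : extChartAt I (f y.proj) (f ((extChartAt I y.proj).symm (extChartAt I.tangent y y).1)) ∈
      (extChartAt I (f y.proj)).target := (extChartAt I (f y.proj)).map_source hyU
  have hmain := flatLift_pullback hφ (hσ.contDiffAt ht)
    ((hσ.contDiffAt hy).differentiableAt (by simp))
    ((eventually_symm_mem hU hy hyU).mono hpull) U V
  have hpt := extChartAt_tangentMap (y₀ := y) (y := y) (y₁ := tangentMap I I f y)
    ((hf y.proj).mdifferentiableAt (by simp)) (mem_extChartAt_source _) (mem_extChartAt_source _)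
  rw [bilinLift_eq, bilinLift_eq, mfderiv_tangentMap_apply hf, mfderiv_tangentMap_apply hf, hpt]
  exact hmain.symm

/-- Applied below to evaluation at a Lie algebra element and to the coadjoint operator. -/
theorem functionLift_clm_comp (L : F →L[ℝ] F') {f : M → F} (hf : ContMDiff I 𝓘(ℝ, F) ∞ f)
    (y : TangentBundle I M) :
    functionLift I (fun x => L (f x)) y = L (functionLift I f y) := by
  have h := (L.hasFDerivAt (x := f y.proj)).hasMFDerivAt.comp y.proj
    ((hf y.proj).mdifferentiableAt (by simp)).hasMFDerivAt
  have h' : HasMFDerivAt I 𝓘(ℝ, F') (fun x => L (f x)) y.proj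
      (L.comp (mvfderiv I f y.proj : E →L[ℝ] F) : E →L[ℝ] F') := h
  exact congrArg (fun T : E →L[ℝ] F' => T (y.2 : E)) h'.mfderiv

theorem functionLift_tangentMap {f : M → F} {g : M' → M} (hf : ContMDiff I 𝓘(ℝ, F) ∞ f)
    (hg : ContMDiff I' I ∞ g) (y : TangentBundle I' M') :
    functionLift I f (tangentMap I' I g y) = functionLift I' (f ∘ g) y := by
  have h := mfderiv_comp y.proj ((hf (g y.proj)).mdifferentiableAt (by simp))
    ((hg y.proj).mdifferentiableAt (by simp))
  exact (congrArg (fun T : E' →L[ℝ] F => T (y.2 : E')) h).symm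

end TangentMap

/-! ### Lifted actions and momentum maps -/

section Actions

variable {E : Type*} [NormedAddCommGroup E] [NormedSpace ℝ E]
  {H : Type*} [TopologicalSpace H] {I : ModelWithCorners ℝ E H} [I.Boundaryless]
  {N : Type*} [TopologicalSpace N] [ChartedSpace H N] [IsManifold I ∞ N]
  {EG : Type*} [NormedAddCommGroup EG] [NormedSpace ℝ EG]
  {HG : Type*} [TopologicalSpace HG] {IG : ModelWithCorners ℝ EG HG} [IG.Boundaryless]
  {G : Type*} [TopologicalSpace G] [ChartedSpace HG G] [Group G] [IsManifold IG ∞ G]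
  {ρ : G → N → N}

theorem IsSmoothAction.contMDiff_right (hρ : IsSmoothAction IG I ρ) (g : G) :
    ContMDiff I I ∞ (ρ g) :=
  hρ.smooth.comp (contMDiff_const.prodMk contMDiff_id)

theorem IsSmoothAction.contMDiff_left (hρ : IsSmoothAction IG I ρ) (x : N) :
    ContMDiff IG I ∞ (fun g => ρ g x) :=
  hρ.smooth.comp (contMDiff_id.prodMk contMDiff_const)

/-- Smoothness jointly in `g` and `y` does not follow from that of each tangent map. It does follow
once the lifted action is the tangent map of `G × N → N` restricted to zero vectors along `G`. -/
theorem IsSmoothAction.actionLift_eq_tangentMap (hρ : IsSmoothAction IG I ρ) (g : G)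
    (y : TangentBundle I N) :
    actionLift I ρ g y = tangentMap (IG.prod I) I (fun p : G × N => ρ p.1 p.2)
      ((equivTangentBundleProd IG G I N).symm (⟨g, 0⟩, y)) := by
  have h1 := mfderiv_comp (I' := IG.prod I) y.proj
    ((hρ.smooth (g, y.proj)).mdifferentiableAt (by simp))
    ((contMDiff_const (c := g) |>.prodMk contMDiff_id : ContMDiff I (IG.prod I) ∞
      (fun x : N => (g, x))) y.proj |>.mdifferentiableAt (by simp))
  rw [mfderiv_prod_right] at h1
  have h2 := congrArg (fun T : E →L[ℝ] E => T (y.2 : E)) h1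
  exact congrArg (fun v : E => (⟨ρ g y.proj, v⟩ : TangentBundle I N)) h2

theorem IsSmoothAction.lift (hρ : IsSmoothAction IG I ρ) :
    IsSmoothAction IG I.tangent (actionLift I ρ) := by
  refine ⟨fun y => ?_, fun g h y => ?_, ?_⟩
  · have e : ρ 1 = id := funext hρ.one
    rw [actionLift, e, tangentMap_id]
    rfl
  · have e : ρ (g * h) = ρ g ∘ ρ h := funext (hρ.mul g h)
    rw [actionLift, e, tangentMap_comp_at _ ((hρ.contMDiff_right g _).mdifferentiableAt (by simp))
      ((hρ.contMDiff_right h _).mdifferentiableAt (by simp))]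
    rfl
  · have e : (fun p : G × TangentBundle I N => actionLift I ρ p.1 p.2) =
        tangentMap (IG.prod I) I (fun p : G × N => ρ p.1 p.2) ∘
          (equivTangentBundleProd IG G I N).symm ∘
            fun p : G × TangentBundle I N => ((⟨p.1, 0⟩ : TangentBundle IG G), p.2) :=
      funext fun p => hρ.actionLift_eq_tangentMap p.1 p.2
    rw [e]
    have h0 : ContMDiff IG IG.tangent ∞ (fun g : G => (⟨g, 0⟩ : TangentBundle IG G)) :=
      contMDiff_zeroSection ℝ (TangentSpace IG : G → Type _)
    exact (hρ.smooth.contMDiff_tangentMap (m := ∞) (by simp)).comp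
      (contMDiff_equivTangentBundleProd_symm.comp
        ((h0.comp contMDiff_fst).prodMk contMDiff_snd))

theorem infinitesimal_components (hρ : IsSmoothAction IG I ρ) (ξ : EG) {x : N} {z : E}
    (hz : z ∈ (extChartAt I x).target) :
    vectorComponents I (infinitesimal IG I ρ ξ) x z =
      fderiv ℝ (fun b => extChartAt I x (ρ ((extChartAt IG (1 : G)).symm b)
        ((extChartAt I x).symm z))) (extChartAt IG (1 : G) 1) ξ := by
  have hs := (extChartAt I x).map_target hz
  have h1 : ρ 1 ((extChartAt I x).symm z) = (extChartAt I x).symm z := hρ.one _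
  have h := fderiv_chartExpression (x₁ := x)
    ((hρ.contMDiff_left ((extChartAt I x).symm z) 1).mdifferentiableAt (by simp))
    (mem_extChartAt_source (I := IG) (1 : G)) (by rw [h1]; exact hs) ξ
  rw [tangentCoordChange_self (mem_extChartAt_source _)] at h
  rw [vectorComponents_eq _ hz]
  refine Eq.trans ?_ h.symm
  exact congrArg (fun q => tangentCoordChange I q x q
    ((mfderiv IG I (fun g : G => ρ g ((extChartAt I x).symm z)) 1 : EG →L[ℝ] E) ξ)) h1.symm

theorem contDiffAt_actionExpression (hρ : IsSmoothAction IG I ρ) (x : N) :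
    ContDiffAt ℝ ∞ (fun q : EG × E => extChartAt I x
      (ρ ((extChartAt IG (1 : G)).symm q.1) ((extChartAt I x).symm q.2)))
      (extChartAt IG (1 : G) 1, extChartAt I x x) := by
  have h := contDiffAt_chartExpression (x₀ := ((1 : G), x)) (x₁ := x)
    (hρ.smooth (1, x)) (mem_extChartAt_source _)
    (by rw [hρ.one]; exact mem_extChartAt_source _)
  rw [extChartAt_prod] at h
  exact h

/-- The infinitesimal transformations of the lifted action are the complete lifts of those of the
given action. -/
theorem infinitesimal_actionLift (hρ : IsSmoothAction IG I ρ) (ξ : GroupLieAlgebra IG G) :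
    infinitesimal IG I.tangent (actionLift I ρ) ξ = vectorLift I (infinitesimal IG I ρ ξ) := by
  funext y
  suffices hs : ∀ ξ : EG, (mfderiv IG I.tangent (fun g : G => actionLift I ρ g y) 1 :
      EG →L[ℝ] E × E) ξ = (vectorLift I (infinitesimal IG I ρ ξ) y : E × E) from hs ξ
  intro ξ
  have h1 : actionLift I ρ 1 y = y := hρ.lift.one y
  have hx : ρ 1 y.proj = y.proj := hρ.one _
  have hy : (extChartAt I.tangent y y).1 ∈ (extChartAt I y.proj).target :=
    mem_extChartAt_target y.proj
  have e : (extChartAt I y.proj).symm (extChartAt I.tangent y y).1 = y.proj :=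
    extChartAt_to_inv (I := I) y.proj
  have h := fderiv_chartExpression (x₁ := y)
    ((hρ.lift.contMDiff_left y 1).mdifferentiableAt (by simp))
    (mem_extChartAt_source (I := IG) (1 : G)) (by rw [h1]; exact mem_extChartAt_source y) ξ
  rw [tangentCoordChange_self (mem_extChartAt_source _)] at h
  -- The unit fixes `y` by an axiom of the action, so the coordinate change is trivial only after
  -- substitution.
  have hself : ∀ q : TangentBundle I N, q = y → ∀ v : E × E,
      tangentCoordChange I.tangent q y q v = v := by
    rintro q rfl v
    exact tangentCoordChange_self (mem_extChartAt_source _)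
  have h' := h.trans (hself _ h1 _)
  refine h'.symm.trans ?_
  -- `A` is the action in charts. The lifted orbit map is `flatTangent` of the family `A (b, ·)`,
  -- while the components of the infinitesimal transformation are the derivative of `A` in `b`;
  -- `fderiv_flatTangent_family` exchanges the two.
  obtain ⟨A, hA⟩ : ∃ A : EG × E → E, A = fun q => extChartAt I y.proj
    (ρ ((extChartAt IG (1 : G)).symm q.1) ((extChartAt I y.proj).symm q.2)) := ⟨_, rfl⟩
  have hAs : ContDiffAt ℝ ∞ A (extChartAt IG (1 : G) 1, (extChartAt I.tangent y y).1) := by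
    rw [hA]
    exact contDiffAt_actionExpression hρ y.proj
  have e1 : (extChartAt I.tangent y ∘ (fun g : G => actionLift I ρ g y) ∘
      (extChartAt IG (1 : G)).symm) =ᶠ[𝓝 (extChartAt IG (1 : G) 1)]
      fun b => flatTangent (fun z => A (b, z)) (extChartAt I.tangent y y) := by
    have hU : IsOpen ((fun g : G => ρ g y.proj) ⁻¹' (extChartAt I y.proj).source) :=
      (isOpen_extChartAt_source _).preimage (hρ.contMDiff_left y.proj).continuous
    filter_upwards [eventually_symm_mem hU (mem_extChartAt_target (I := IG) (1 : G)) (by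
      rw [extChartAt_to_inv, Set.mem_preimage, hx]; exact mem_extChartAt_source _)] with b hb
    rw [hA]
    exact extChartAt_tangentMap (y₁ := y) ((hρ.contMDiff_right _ _).mdifferentiableAt (by simp))
      (mem_extChartAt_source _) hb.2
  have e2 : vectorComponents I (infinitesimal IG I ρ ξ) y.proj
      =ᶠ[𝓝 (extChartAt I.tangent y y).1]
      fun z => fderiv ℝ (fun b => A (b, z)) (extChartAt IG (1 : G) 1) ξ :=
    Filter.eventually_of_mem ((isOpen_extChartAt_target y.proj).mem_nhds hy) fun z hz => by
      rw [hA]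
      exact infinitesimal_components hρ ξ hz
  rw [e1.fderiv_eq, fderiv_flatTangent_family hAs, vectorLift_eq, flatTangent, flatTangent,
    e2.fderiv_eq, e2.self_of_nhds]

theorem IsHamiltonianAction.lift {σ : BilinField I N} (hσ : IsAlmostSymplectic I σ)
    (h : IsHamiltonianAction IG I σ ρ) :
    IsHamiltonianAction IG I.tangent (bilinLift I σ) (actionLift I ρ) := by
  refine ⟨h.action.lift, fun g y U V => ?_, fun ξ => ?_⟩
  · exact bilinLift_tangentMap hσ (h.action.contMDiff_right g) (h.preserves g) y U V
  · obtain ⟨f, hf⟩ := h.hamiltonian ξ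
    exact ⟨functionLift I f, infinitesimal_actionLift h.action ξ ▸ hf.lift hσ⟩

theorem IsEquivariantMomentumMap.lift {σ : BilinField I N} (hσ : IsAlmostSymplectic I σ)
    (hρ : IsSmoothAction IG I ρ) {Φ : N → DualLieAlgebra EG}
    (h : IsEquivariantMomentumMap IG I σ ρ Φ) :
    IsEquivariantMomentumMap IG I.tangent (bilinLift I σ) (actionLift I ρ)
      (functionLift I Φ) := by
  refine ⟨contMDiff_functionLift h.smooth, fun ξ => ?_, fun g y => ?_⟩
  · have e : ∀ ξ : EG, functionLift I (fun x => Φ x ξ) = fun y => functionLift I Φ y ξ :=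
      fun ξ => funext fun y =>
        functionLift_clm_comp (ContinuousLinearMap.apply ℝ ℝ ξ) h.smooth y
    have hξ := (h.hamiltonian ξ).lift hσ
    rw [← infinitesimal_actionLift hρ] at hξ
    exact Eq.mp (congrArg (IsHamiltonian I.tangent (bilinLift I σ)
      (infinitesimal IG I.tangent (actionLift I ρ) ξ)) (e ξ)) hξ
  -- For fixed `g` the coadjoint action is a continuous linear map of `𝔤*`, so it commutes with the
  -- lift.
  · have e : Φ ∘ ρ g = fun x => (ContinuousLinearMap.compL ℝ EG EG ℝ).flip
        (adjointMap IG g⁻¹ : EG →L[ℝ] EG) (Φ x) := funext fun x => h.equivariant g x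
    refine (functionLift_tangentMap h.smooth (hρ.contMDiff_right g) y).trans ?_
    rw [e, functionLift_clm_comp _ h.smooth]
    rfl

end Actions

end AlmostSymplectic

end

open AlmostSymplectic in
theorem proposition4p1
    {E : Type*} [NormedAddCommGroup E] [NormedSpace ℝ E] [FiniteDimensional ℝ E]
    {H : Type*} [TopologicalSpace H] (I : ModelWithCorners ℝ E H) [I.Boundaryless]
    {N : Type*} [TopologicalSpace N] [ChartedSpace H N] [IsManifold I ∞ N]
    {EG : Type*} [NormedAddCommGroup EG] [NormedSpace ℝ EG] [FiniteDimensional ℝ EG]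
    {HG : Type*} [TopologicalSpace HG] (IG : ModelWithCorners ℝ EG HG) [IG.Boundaryless]
    {G : Type*} [TopologicalSpace G] [ChartedSpace HG G] [Group G] [LieGroup IG ∞ G]
    (σ : BilinField I N) (hσ : IsAlmostSymplectic I σ) :
    IsAlmostSymplectic I.tangent (bilinLift I σ) ∧
    (∀ (X : (x : N) → TangentSpace I x) (f : N → ℝ), IsHamiltonian I σ X f →
      IsHamiltonian I.tangent (bilinLift I σ) (vectorLift I X) (functionLift I f)) ∧
    (∀ ρ : G → N → N, IsHamiltonianAction IG I σ ρ →
      IsHamiltonianAction IG I.tangent (bilinLift I σ) (actionLift I ρ)) ∧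
    (∀ (ρ : G → N → N) (Φ : N → DualLieAlgebra EG), IsSmoothAction IG I ρ →
      IsEquivariantMomentumMap IG I σ ρ Φ →
        IsSmoothAction IG I.tangent (actionLift I ρ) ∧
        IsEquivariantMomentumMap IG I.tangent (bilinLift I σ) (actionLift I ρ)
          (functionLift I Φ)) := by
  exact ⟨hσ.bilinLift, fun X f h => h.lift hσ, fun ρ h => h.lift hσ,
    fun ρ Φ hρ h => ⟨hρ.lift, h.lift hσ hρ⟩⟩
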